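/- For a positive integer $n$ let $F_{3,3}(n)$ denote the maximal size of a set $A\subseteq\{1,2,\dots,n\}$ such that the equation $a_1a_2a_3=x^3$, $a_1<a_2<a_3$, has no solution with $a_1,a_2,a_3\in A$ and $x$ an integer. Then there exists a constant $C_{3,3}$ with $0.6919\le C_{3,3}\le 0.7136$ such that $F_{3,3}(n)=(C_{3,3}+o(1))\,n$ as $n\to\infty$; that is, $\lim_{n\to\infty}F_{3,3}(n)/n=C_{3,3}$. -/

import Mathlib

open Filter Topology

/-- A set `A` of positive integers has property `P_{k,d}`: the equation
`a₁ a₂ ⋯ a_k = x ^ d` with `a₁ < a₂ < ⋯ < a_k` has no solution with all `a_i ∈ A`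
and `x` an integer. -/
def HasPropertyP (k d : ℕ) (A : Finset ℕ) : Prop :=
  ¬ ∃ (a : Fin k → ℕ) (x : ℤ),
    StrictMono a ∧ (∀ i, a i ∈ A) ∧ (∏ i, (a i : ℤ)) = x ^ d

open scoped Classical in
/-- `F_{k,d}(n)`: the maximal size of a set `A ⊆ {1, …, n}` with property `P_{k,d}`
(for `k ≥ 1` the empty set has this property, so the maximum is over a nonempty finite family). -/
noncomputable def maxSizeF (k d n : ℕ) : ℕ :=
  ((Finset.Icc 1 n).powerset.filter (HasPropertyP k d)).sup Finset.card

/-!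
Write `F n` for `maxSizeF 3 3 n` and fix a finite list `ps` of primes with product `N`. Each positive
integer is uniquely `s * m` with `s` smooth over `ps` and `m` coprime to `N`. Let `g k`, which is
`smoothMax ps k`, be the largest size of a set of smooth numbers up to `k` with the property.

* For fixed `m`, the smooth parts of the elements `s * m` of a set with the property again have the
  property, because `m ^ 3` is a cube. Hence `F n ≤ ∑ g (n / m)` over all `m ≤ n` coprime to `N`
  (`maxSizeF_le_sum`).
* If `m` runs through *square-free* numbers only, then an optimal set of smooth numbers may be taken for
  each `m` separately: for square-free `m₁`, `m₂`, `m₃` coprime to `N`, the product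
  `s₁ m₁ s₂ m₂ s₃ m₃` is a cube only if `m₁ = m₂ = m₃`. Hence `F n ≥ ∑ g (n / m)` over the square-free
  `m ≤ n` coprime to `N` (`sum_le_maxSizeF`).

The function `g` is nondecreasing and bounded, so it is a step function with finitely many jumps `x`,
and interchanging the summations turns both sums into `n` times an explicit constant
(`exists_tendsto_ge`, `exists_tendsto_le`): with `L = φ(N) / N * ∑ 1 / x`, the upper limit of `F n / n`
is at most `L` and the lower limit is at least `(1 - σ) * L`, where `σ` is the sum of `1 / d ^ 2` over
the `d ≥ 2` coprime to `N`. For `N` the product of all primes below `K`, the number `σ` tends to zero as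
`K` grows, so the limit exists (`exists_tendsto_maxSizeF_div`).

The numerical bounds come from bounds of `g` by explicit step functions. Three smooth numbers multiply
to a cube iff their exponent vectors modulo three add up to zero, that is, iff these vectors are all
equal or are the points of a line of the affine space `(ℤ/3)^r`, `r = ps.length`. So a set of smooth
numbers has the property iff its exponent vectors form a cap (a set without three points on a line)
and each vector is that of at most two elements. The least two smooth numbers with a given vector are its
cube-free representative and, if `2` is in `ps`, eight times that. Thus `g k` is a maximum of weights
`capWeight` of caps.

* For `ps = [2, 3, 5, 7]`, `capWeight_le_stepCount` bounds the weight of all caps. For large `k`, this is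
  the fact that a cap of `(ℤ/3)^4` has at most `20` points, proved by counting pairs and triples
  of points in hyperplanes (`card_le_of_isCap_four`). For the other values, it is a branch and bound
  search run by the kernel (`search`, `search_sound`), where the layers with constant exponent of `7`
  are bounded by a search in `(ℤ/3)^3`, and planes contain at most four points of a cap.
* For `ps = [2, 3, 5, 7, 11]`, explicit caps give `stepCount_le_smoothMax`, and
  `invSqTail_2310_le` bounds `σ` by means of `∑ 1 / d ^ 2 = π ^ 2 / 6`.
-/

/-! ### The property in terms of prime exponents -/

/-- The property `P_{3,3}` without tuples. -/
theorem hasPropertyP_three_iff {A : Finset ℕ} :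
    HasPropertyP 3 3 A ↔
      ∀ a ∈ A, ∀ b ∈ A, ∀ c ∈ A, a < b → b < c → ∀ x : ℤ, (a : ℤ) * b * c ≠ x ^ 3 := by
  unfold HasPropertyP
  constructor
  · intro h a ha b hb c hc hab hbc x hx
    refine h ⟨![a, b, c], x, ?_, ?_, ?_⟩
    · rw [Fin.strictMono_iff_lt_succ]
      intro i
      fin_cases i <;> simpa
    · intro i
      fin_cases i <;> simpa
    · simpa [Fin.prod_univ_three] using hx
  · rintro h ⟨a, x, hm, hA, hx⟩
    refine h _ (hA 0) _ (hA 1) _ (hA 2) (hm (by decide)) (hm (by decide)) x ?_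
    simpa [Fin.prod_univ_three] using hx

theorem exists_int_cube_iff {a : ℕ} (ha : a ≠ 0) :
    (∃ x : ℤ, (a : ℤ) = x ^ 3) ↔ ∀ p, 3 ∣ a.factorization p := by
  constructor
  · rintro ⟨x, hx⟩ p
    have h : a = x.natAbs ^ 3 := by
      have := congrArg Int.natAbs hx
      simpa [Int.natAbs_pow] using this
    rw [h, Nat.factorization_pow]
    simp
  · intro h
    refine ⟨(Nat.floorRoot 3 a : ℕ), ?_⟩
    have : a = (Nat.floorRoot 3 a) ^ 3 := by
      apply Nat.eq_of_factorization_eq ha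
      · simp [ha]
      · intro p
        rw [Nat.factorization_pow, Nat.factorization_floorRoot]
        simp only [Finsupp.smul_apply, smul_eq_mul, Finsupp.floorDiv_apply, Nat.floorDiv_eq_div]
        exact (Nat.mul_div_cancel' (h p)).symm
    exact_mod_cast this

/-- For three distinct members of a set with the property, the sum of the exponents of some prime
is not divisible by three. -/
theorem HasPropertyP.exists_factorization {A : Finset ℕ} (h : HasPropertyP 3 3 A)
    {a b c : ℕ} (ha : a ∈ A) (hb : b ∈ A) (hc : c ∈ A) (ha0 : a ≠ 0) (hb0 : b ≠ 0) (hc0 : c ≠ 0)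
    (hab : a ≠ b) (hac : a ≠ c) (hbc : b ≠ c) :
    ∃ p, ¬ 3 ∣ a.factorization p + b.factorization p + c.factorization p := by
  by_contra! hcon
  have h0 : a * b * c ≠ 0 := by positivity
  obtain ⟨x, hx⟩ := (exists_int_cube_iff h0).2 (by
    intro p
    rw [Nat.factorization_mul (by positivity) hc0, Nat.factorization_mul ha0 hb0]
    exact hcon p)
  rw [hasPropertyP_three_iff] at h
  push_cast at hx
  rcases lt_or_gt_of_ne hab with h1 | h1 <;> rcases lt_or_gt_of_ne hac with h2 | h2 <;>
    rcases lt_or_gt_of_ne hbc with h3 | h3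
  · exact h a ha b hb c hc h1 h3 x hx
  · exact h a ha c hc b hb h2 h3 x (by rw [← hx]; ring)
  · omega
  · exact h c hc a ha b hb h2 h1 x (by rw [← hx]; ring)
  · exact h b hb a ha c hc h1 h2 x (by rw [← hx]; ring)
  · omega
  · exact h b hb c hc a ha h3 h2 x (by rw [← hx]; ring)
  · exact h c hc b hb a ha h3 h1 x (by rw [← hx]; ring)

theorem hasPropertyP_of_forall {A : Finset ℕ} (h0 : ∀ a ∈ A, a ≠ 0)
    (h : ∀ a ∈ A, ∀ b ∈ A, ∀ c ∈ A, a ≠ b → a ≠ c → b ≠ c →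
      (∀ p, 3 ∣ a.factorization p + b.factorization p + c.factorization p) → False) :
    HasPropertyP 3 3 A := by
  rw [hasPropertyP_three_iff]
  intro a ha b hb c hc hab hbc x hx
  refine h a ha b hb c hc hab.ne (hab.trans hbc).ne hbc.ne ?_
  have h1 := h0 a ha
  have h2 := h0 b hb
  have h3 := h0 c hc
  intro p
  have := (exists_int_cube_iff (a := a * b * c) (by positivity)).1 ⟨x, by push_cast; exact hx⟩ p
  rwa [Nat.factorization_mul (by positivity) h3, Nat.factorization_mul h1 h2] at this

/-! ### Exponent vectors modulo three, and caps -/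

/-- `s` is a positive integer all of whose prime factors lie in the list `ps`. -/
def IsSmooth (ps : List ℕ) (s : ℕ) : Prop := s ≠ 0 ∧ ∀ p, p.Prime → p ∣ s → p ∈ ps

/-- The exponents of `s` at the primes of `ps`, read modulo three and packed into one natural
number, the head of the list giving the least significant ternary digit. -/
def code : List ℕ → ℕ → ℕ
  | [], _ => 0
  | p :: ps, s => s.factorization p % 3 + 3 * code ps s

/-- The third point on the line through `x` and `y` in the affine space `(ℤ/3)^r`, whose points are
written as natural numbers with `r` ternary digits: digitwise `-(x + y)`. -/
def third : ℕ → ℕ → ℕ → ℕ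
  | 0, _, _ => 0
  | r + 1, x, y => (6 - x % 3 - y % 3) % 3 + 3 * third r (x / 3) (y / 3)

/-- The cube-free number whose exponents at the primes of `ps` are the ternary digits of `c`. -/
def rep : List ℕ → ℕ → ℕ
  | [], _ => 1
  | p :: ps, c => p ^ (c % 3) * rep ps (c / 3)

/-- A set of points of `(ℤ/3)^r` without three distinct points on a line. -/
def IsCap (r : ℕ) (C : Finset ℕ) : Prop :=
  ∀ x ∈ C, ∀ y ∈ C, x ≠ y → third r x y ∉ C

theorem IsCap.mono {r : ℕ} {C D : Finset ℕ} (h : IsCap r D) (hCD : C ⊆ D) : IsCap r C :=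
  fun x hx y hy hxy hz => h x (hCD hx) y (hCD hy) hxy (hCD hz)

theorem code_lt (ps : List ℕ) (s : ℕ) : code ps s < 3 ^ ps.length := by
  induction ps with
  | nil => simp [code]
  | cons p ps ih =>
    simp only [code, List.length_cons, pow_succ]
    omega

/-- The exponents of `a * b * c` at the primes of `ps` are divisible by three iff the exponent vectors
of `a`, `b`, `c` are equal or form a line. -/
theorem code_eq_third_iff (ps : List ℕ) (a b c : ℕ) :
    code ps c = third ps.length (code ps a) (code ps b) ↔
      ∀ p ∈ ps, 3 ∣ a.factorization p + b.factorization p + c.factorization p := by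
  induction ps with
  | nil => simp [code, third]
  | cons p ps ih =>
    simp only [code, List.length_cons, third, List.mem_cons, forall_eq_or_imp, ← ih]
    have h1 : (a.factorization p % 3 + 3 * code ps a) / 3 = code ps a := by omega
    have h2 : (b.factorization p % 3 + 3 * code ps b) / 3 = code ps b := by omega
    rw [h1, h2]
    omega

theorem third_lt (r x y : ℕ) : third r x y < 3 ^ r := by
  induction r generalizing x y with
  | zero => simp [third]
  | succ r ih =>
    have := ih (x / 3) (y / 3)
    simp only [third, pow_succ]
    omega

theorem third_self {r x : ℕ} (hx : x < 3 ^ r) : third r x x = x := by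
  induction r generalizing x with
  | zero => simp [third]; simp at hx; exact hx.symm
  | succ r ih =>
    have := ih (x := x / 3) (by rw [pow_succ] at hx; omega)
    simp only [third, this]
    omega

theorem third_comm (r x y : ℕ) : third r x y = third r y x := by
  induction r generalizing x y with
  | zero => rfl
  | succ r ih =>
    simp only [third, ih (x / 3)]
    omega

/-- Two of three collinear points can only agree if all three do. -/
theorem eq_of_third_eq_left {r x y : ℕ} (hx : x < 3 ^ r) (hy : y < 3 ^ r)
    (h : third r x y = x) : x = y := by
  induction r generalizing x y with
  | zero => simp at hx hy; omega
  | succ r ih =>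
    rw [pow_succ] at hx hy
    simp only [third] at h
    have := ih (x := x / 3) (y := y / 3) (by omega) (by omega) (by omega)
    omega

theorem eq_of_third_eq_right {r x y : ℕ} (hx : x < 3 ^ r) (hy : y < 3 ^ r)
    (h : third r x y = y) : x = y :=
  (eq_of_third_eq_left hy hx (by rw [third_comm]; exact h)).symm

theorem rep_pos {ps : List ℕ} (hp : ∀ p ∈ ps, p.Prime) (c : ℕ) : 0 < rep ps c := by
  induction ps generalizing c with
  | nil => simp [rep]
  | cons p ps ih =>
    have h1 := (hp p (by simp)).pos
    have h2 := ih (fun q hq => hp q (by simp [hq])) (c / 3)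
    simp only [rep]
    positivity

theorem isSmooth_rep {ps : List ℕ} (hp : ∀ p ∈ ps, p.Prime) (c : ℕ) : IsSmooth ps (rep ps c) := by
  refine ⟨(rep_pos hp c).ne', ?_⟩
  induction ps generalizing c with
  | nil =>
    intro q hq h
    simp [rep] at h
    exact absurd (h ▸ hq) Nat.not_prime_one
  | cons p ps ih =>
    intro q hq h
    rcases (hq.dvd_mul).1 h with h | h
    · have := (Nat.prime_dvd_prime_iff_eq hq (hp p (by simp))).1 (hq.dvd_of_dvd_pow h)
      simp [this]
    · exact List.mem_cons_of_mem _ (ih (fun q hq => hp q (by simp [hq])) _ q hq h)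

/-- A smooth number is its cube-free representative times a cube. -/
theorem exists_eq_rep_mul_cube {ps : List ℕ} (hp : ∀ p ∈ ps, p.Prime) (hn : ps.Nodup)
    {s : ℕ} (hs : IsSmooth ps s) : ∃ b, s = rep ps (code ps s) * b ^ 3 := by
  induction ps generalizing s with
  | nil =>
    refine ⟨1, ?_⟩
    have : s = 1 := by
      by_contra h
      obtain ⟨q, hq, hqs⟩ := Nat.exists_prime_and_dvd h
      simpa using hs.2 q hq hqs
    simp [rep, this]
  | cons p ps ih =>
    have hpp := hp p (by simp)
    rw [List.nodup_cons] at hn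
    set t := s / p ^ s.factorization p with ht
    have hst : p ^ s.factorization p * t = s := Nat.ordProj_mul_ordCompl_eq_self s p
    have ht0 : t ≠ 0 := by
      rintro h; rw [h] at hst; exact hs.1 (by simpa using hst.symm)
    have hpt : ¬ p ∣ t := Nat.not_dvd_ordCompl hpp hs.1
    have hts : IsSmooth ps t := by
      refine ⟨ht0, fun q hq hqt => ?_⟩
      have := hs.2 q hq (hst ▸ Dvd.dvd.mul_left hqt _)
      rcases List.mem_cons.1 this with h | h
      · exact absurd (h ▸ hqt) hpt
      · exact h
    obtain ⟨b, hb⟩ := ih (fun q hq => hp q (by simp [hq])) hn.2 hts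
    have hcode : code ps t = code ps s := by
      have key : ∀ l : List ℕ, (∀ q ∈ l, q ≠ p) → code l t = code l s := by
        intro l hl
        induction l with
        | nil => rfl
        | cons q l ihl =>
          simp only [code]
          rw [ihl (fun r hr => hl r (by simp [hr]))]
          have : t.factorization q = s.factorization q := by
            rw [ht, Nat.factorization_ordCompl, Finsupp.erase_ne (hl q (by simp))]
          rw [this]
      exact key ps (fun q hq h => hn.1 (h ▸ hq))
    refine ⟨p ^ (s.factorization p / 3) * b, ?_⟩
    simp only [code, rep]
    have h1 : (s.factorization p % 3 + 3 * code ps s) % 3 = s.factorization p % 3 := by omega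
    have h2 : (s.factorization p % 3 + 3 * code ps s) / 3 = code ps s := by omega
    rw [h1, h2, ← hcode]
    calc s = p ^ s.factorization p * t := hst.symm
      _ = p ^ (s.factorization p % 3 + 3 * (s.factorization p / 3)) *
            (rep ps (code ps t) * b ^ 3) := by rw [Nat.mod_add_div, ← hb]
      _ = _ := by rw [pow_add, pow_mul']; ring

theorem factorization_rep_of_notMem {ps : List ℕ} (hp : ∀ p ∈ ps, p.Prime) {q : ℕ}
    (hq : q ∉ ps) (c : ℕ) : (rep ps c).factorization q = 0 := by
  by_cases hqp : q.Prime
  · exact Nat.factorization_eq_zero_of_not_dvd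
      fun h => hq ((isSmooth_rep hp c).2 q hqp h)
  · exact Nat.factorization_eq_zero_of_not_prime _ hqp

theorem code_congr {ps : List ℕ} {a b : ℕ}
    (h : ∀ p ∈ ps, a.factorization p % 3 = b.factorization p % 3) : code ps a = code ps b := by
  induction ps with
  | nil => rfl
  | cons q l ihl =>
    simp only [code]
    rw [ihl (fun r hr => h r (by simp [hr])), h q (by simp)]

theorem code_rep {ps : List ℕ} (hp : ∀ p ∈ ps, p.Prime) (hn : ps.Nodup)
    {c : ℕ} (hc : c < 3 ^ ps.length) : code ps (rep ps c) = c := by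
  induction ps generalizing c with
  | nil => simp at hc; simp [code, hc]
  | cons p ps ih =>
    rw [List.nodup_cons] at hn
    have hp' : ∀ q ∈ ps, q.Prime := fun q hq => hp q (by simp [hq])
    have hpp := hp p (by simp)
    rw [List.length_cons, pow_succ] at hc
    have hi := ih hp' hn.2 (c := c / 3) (by omega)
    have hr := (rep_pos hp' (c / 3)).ne'
    simp only [code, rep]
    rw [Nat.factorization_mul (pow_ne_zero _ hpp.ne_zero) hr]
    simp only [Finsupp.add_apply, hpp.factorization_pow, Finsupp.single_eq_same,
      factorization_rep_of_notMem hp' hn.1]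
    have : code ps (p ^ (c % 3) * rep ps (c / 3)) = code ps (rep ps (c / 3)) := by
      apply code_congr
      intro q hq
      rw [Nat.factorization_mul (pow_ne_zero _ hpp.ne_zero) hr]
      have : q ≠ p := fun h => hn.1 (h ▸ hq)
      simp [hpp.factorization_pow, Finsupp.single_eq_of_ne this]
    rw [this, hi]
    omega

theorem code_cube_mul (ps : List ℕ) {s b : ℕ} (hs : s ≠ 0) (hb : b ≠ 0) :
    code ps (b ^ 3 * s) = code ps s := by
  apply code_congr
  intro p _
  rw [Nat.factorization_mul (by positivity) hs, Nat.factorization_pow]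
  simp

/-! ### Caps and sets of smooth numbers with the property -/

/-- The number of elements not exceeding `y` among the numbers `rep c` and `8 * rep c`, `c ∈ C`. -/
def capWeight (ps : List ℕ) (C : Finset ℕ) (y : ℕ) : ℕ :=
  (C.filter fun c => rep ps c ≤ y).card + (C.filter fun c => 8 * rep ps c ≤ y).card

theorem isCap_image_code {ps : List ℕ} {A : Finset ℕ} (hA : HasPropertyP 3 3 A)
    (hs : ∀ a ∈ A, IsSmooth ps a) : IsCap ps.length (A.image (code ps)) := by
  intro x hx y hy hxy hz
  obtain ⟨a, ha, rfl⟩ := Finset.mem_image.1 hx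
  obtain ⟨b, hb, rfl⟩ := Finset.mem_image.1 hy
  obtain ⟨c, hc, hcz⟩ := Finset.mem_image.1 hz
  have hac : a ≠ c := by
    rintro rfl
    exact hxy (eq_of_third_eq_left (code_lt _ _) (code_lt _ _) hcz.symm)
  have hbc : b ≠ c := by
    rintro rfl
    exact hxy (eq_of_third_eq_right (code_lt _ _) (code_lt _ _) hcz.symm)
  have hab : a ≠ b := by rintro rfl; exact hxy rfl
  obtain ⟨p, hp⟩ := hA.exists_factorization ha hb hc (hs a ha).1 (hs b hb).1 (hs c hc).1 hab hac hbc
  refine hp ?_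
  by_cases hpp : p ∈ ps
  · exact (code_eq_third_iff ps a b c).1 hcz p hpp
  · have h0 : ∀ d ∈ A, d.factorization p = 0 := fun d hd => by
      by_cases hpr : p.Prime
      · exact Nat.factorization_eq_zero_of_not_dvd fun h => hpp ((hs d hd).2 p hpr h)
      · exact Nat.factorization_eq_zero_of_not_prime _ hpr
    simp [h0 a ha, h0 b hb, h0 c hc]

/-- A set with the property has at most two elements in each exponent class. -/
theorem card_code_fiber_le {ps : List ℕ} {A : Finset ℕ} (hA : HasPropertyP 3 3 A)
    (hs : ∀ a ∈ A, IsSmooth ps a) (x : ℕ) : (A.filter fun a => code ps a = x).card ≤ 2 := by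
  by_contra! h
  obtain ⟨a, b, c, ha, hb, hc, hab, hac, hbc⟩ := Finset.two_lt_card_iff.1 h
  rw [Finset.mem_filter] at ha hb hc
  obtain ⟨p, hp⟩ := hA.exists_factorization ha.1 hb.1 hc.1 (hs a ha.1).1 (hs b hb.1).1 (hs c hc.1).1
    hab hac hbc
  refine hp ?_
  by_cases hpp : p ∈ ps
  · refine (code_eq_third_iff ps a b c).1 ?_ p hpp
    rw [ha.2, hb.2, hc.2, third_self]
    rw [← ha.2]; exact code_lt _ _
  · have h0 : ∀ d ∈ A, d.factorization p = 0 := fun d hd => by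
      by_cases hpr : p.Prime
      · exact Nat.factorization_eq_zero_of_not_dvd fun h => hpp ((hs d hd).2 p hpr h)
      · exact Nat.factorization_eq_zero_of_not_prime _ hpr
    simp [h0 a ha.1, h0 b hb.1, h0 c hc.1]

/-- The first element of a class is at least `rep c`, the second at least `8 * rep c`. -/
theorem card_le_capWeight {ps : List ℕ} (hp : ∀ p ∈ ps, p.Prime) (hn : ps.Nodup) {A : Finset ℕ}
    (hA : HasPropertyP 3 3 A) (hs : ∀ a ∈ A, IsSmooth ps a) {y : ℕ} (hy : ∀ a ∈ A, a ≤ y) :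
    A.card ≤ capWeight ps (A.image (code ps)) y := by
  rw [capWeight, Finset.card_filter, Finset.card_filter, ← Finset.sum_add_distrib,
    Finset.card_eq_sum_card_image (code ps) A]
  apply Finset.sum_le_sum
  intro x hx
  have h2 := card_code_fiber_le hA hs x
  have hex : ∀ a ∈ A.filter (fun a => code ps a = x), ∃ b, 0 < b ∧ a = rep ps x * b ^ 3 := by
    intro a ha
    rw [Finset.mem_filter] at ha
    obtain ⟨b, hb⟩ := exists_eq_rep_mul_cube hp hn (hs a ha.1)
    rw [ha.2] at hb
    refine ⟨b, Nat.pos_of_ne_zero ?_, hb⟩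
    rintro rfl
    exact (hs a ha.1).1 (by simpa using hb)
  have hpos := rep_pos hp x
  have h1 : rep ps x ≤ y := by
    obtain ⟨a, ha, hax⟩ := Finset.mem_image.1 hx
    obtain ⟨b, hb, hab⟩ := hex a (by simp [ha, hax])
    calc rep ps x ≤ rep ps x * b ^ 3 := Nat.le_mul_of_pos_right _ (by positivity)
      _ = a := hab.symm
      _ ≤ y := hy a ha
  rw [if_pos h1]
  by_cases h8 : 8 * rep ps x ≤ y
  · rw [if_pos h8]; exact h2
  · rw [if_neg h8]
    by_contra! hcon
    obtain ⟨a, ha, a', ha', hne⟩ := Finset.one_lt_card.1 hcon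
    have hone : ∀ a ∈ A.filter (fun a => code ps a = x), a = rep ps x := by
      intro a ha
      obtain ⟨b, hb, hab⟩ := hex a ha
      have hb1 : b < 2 := by
        by_contra! hb2
        apply h8
        calc 8 * rep ps x = rep ps x * 2 ^ 3 := by ring
          _ ≤ rep ps x * b ^ 3 := by gcongr
          _ = a := hab.symm
          _ ≤ y := hy a (Finset.mem_filter.1 ha).1
      have : b = 1 := by omega
      rw [hab, this]; simp
    exact hne ((hone a ha).trans (hone a' ha').symm)

/-- The numbers `rep c` and `8 * rep c` with `c ∈ C` that do not exceed `y`. -/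
def capSet (ps : List ℕ) (C : Finset ℕ) (y : ℕ) : Finset ℕ :=
  ((C.filter fun c => rep ps c ≤ y).image (rep ps)) ∪
    ((C.filter fun c => 8 * rep ps c ≤ y).image fun c => 8 * rep ps c)

theorem mem_capSet {ps : List ℕ} {C : Finset ℕ} {y s : ℕ} :
    s ∈ capSet ps C y ↔ s ≤ y ∧ ∃ c ∈ C, s = rep ps c ∨ s = 8 * rep ps c := by
  simp only [capSet, Finset.mem_union, Finset.mem_image, Finset.mem_filter]
  constructor
  · rintro (⟨c, ⟨hc, hy⟩, rfl⟩ | ⟨c, ⟨hc, hy⟩, rfl⟩)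
    · exact ⟨hy, c, hc, Or.inl rfl⟩
    · exact ⟨hy, c, hc, Or.inr rfl⟩
  · rintro ⟨hy, c, hc, rfl | rfl⟩
    · exact Or.inl ⟨c, ⟨hc, hy⟩, rfl⟩
    · exact Or.inr ⟨c, ⟨hc, hy⟩, rfl⟩

theorem isSmooth_of_mem_capSet {ps : List ℕ} (hp : ∀ p ∈ ps, p.Prime) (h2 : 2 ∈ ps)
    {C : Finset ℕ} {y s : ℕ} (hs : s ∈ capSet ps C y) : IsSmooth ps s := by
  obtain ⟨-, c, -, rfl | rfl⟩ := mem_capSet.1 hs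
  · exact isSmooth_rep hp c
  · have := isSmooth_rep hp c
    refine ⟨mul_ne_zero (by norm_num) this.1, fun q hq h => ?_⟩
    rcases (hq.dvd_mul).1 h with h | h
    · have : q ∣ 2 := hq.dvd_of_dvd_pow (n := 3) (by simpa using h)
      rw [(Nat.prime_dvd_prime_iff_eq hq Nat.prime_two).1 this]
      exact h2
    · exact this.2 q hq h

theorem code_of_mem {ps : List ℕ} (hp : ∀ p ∈ ps, p.Prime) (hn : ps.Nodup) {c s : ℕ}
    (hc : c < 3 ^ ps.length) (hs : s = rep ps c ∨ s = 8 * rep ps c) : code ps s = c := by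
  rcases hs with rfl | rfl
  · exact code_rep hp hn hc
  · have := code_cube_mul ps (s := rep ps c) (b := 2) (rep_pos hp c).ne' (by norm_num)
    norm_num at this
    rw [this]
    exact code_rep hp hn hc

theorem hasPropertyP_capSet {ps : List ℕ} (hp : ∀ p ∈ ps, p.Prime) (hn : ps.Nodup) (h2 : 2 ∈ ps)
    {C : Finset ℕ} (hC : IsCap ps.length C) (hlt : ∀ c ∈ C, c < 3 ^ ps.length) (y : ℕ) :
    HasPropertyP 3 3 (capSet ps C y) := by
  refine hasPropertyP_of_forall (fun a ha => (isSmooth_of_mem_capSet hp h2 ha).1) ?_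
  intro a ha b hb c hc hab hac hbc h
  obtain ⟨-, x, hx, hax⟩ := mem_capSet.1 ha
  obtain ⟨-, z, hz, hbz⟩ := mem_capSet.1 hb
  obtain ⟨-, w, hw, hcw⟩ := mem_capSet.1 hc
  have hthird := (code_eq_third_iff ps a b c).2 fun p _ => h p
  rw [code_of_mem hp hn (hlt x hx) hax, code_of_mem hp hn (hlt z hz) hbz,
    code_of_mem hp hn (hlt w hw) hcw] at hthird
  by_cases hxz : x = z
  · subst hxz
    rw [third_self (hlt _ hx)] at hthird
    subst hthird
    -- three distinct numbers, each equal to `rep w` or `8 * rep w`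
    omega
  · exact hC x hx z hz hxz (hthird ▸ hw)

theorem card_capSet {ps : List ℕ} (hp : ∀ p ∈ ps, p.Prime) (hn : ps.Nodup)
    {C : Finset ℕ} (hlt : ∀ c ∈ C, c < 3 ^ ps.length) (y : ℕ) :
    (capSet ps C y).card = capWeight ps C y := by
  have hinj : ∀ c ∈ C, ∀ d ∈ C, rep ps c = rep ps d → c = d := by
    intro c hc d hd h
    rw [← code_rep hp hn (hlt c hc), ← code_rep hp hn (hlt d hd), h]
  rw [capSet, capWeight, Finset.card_union_of_disjoint, Finset.card_image_of_injOn,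
    Finset.card_image_of_injOn]
  · intro c hc d hd h
    simp only [Finset.coe_filter, Set.mem_ofPred_eq] at hc hd
    exact hinj c hc.1 d hd.1 (by simp only at h; omega)
  · intro c hc d hd h
    simp only [Finset.coe_filter, Set.mem_ofPred_eq] at hc hd
    exact hinj c hc.1 d hd.1 h
  · rw [Finset.disjoint_left]
    intro s hs hs'
    simp only [Finset.mem_image, Finset.mem_filter] at hs hs'
    obtain ⟨c, ⟨hc, -⟩, rfl⟩ := hs
    obtain ⟨d, ⟨hd, -⟩, h⟩ := hs'
    have h1 := code_of_mem hp hn (hlt c hc) (Or.inl rfl)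
    have h2 := code_of_mem hp hn (hlt d hd) (Or.inr rfl)
    rw [h, h1] at h2
    subst h2
    have := rep_pos hp c
    omega

/-! ### Optimal sets of smooth numbers -/

open scoped Classical in
/-- The maximal size of a set with the property consisting of smooth numbers up to `k`. -/
noncomputable def smoothMax (ps : List ℕ) (k : ℕ) : ℕ :=
  (((Finset.Icc 1 k).filter (IsSmooth ps)).powerset.filter (HasPropertyP 3 3)).sup Finset.card

theorem le_smoothMax {ps : List ℕ} {k : ℕ} {A : Finset ℕ} (hA : HasPropertyP 3 3 A)
    (hs : ∀ a ∈ A, IsSmooth ps a) (hk : ∀ a ∈ A, a ≤ k) : A.card ≤ smoothMax ps k := by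
  classical
  unfold smoothMax
  refine Finset.le_sup (f := Finset.card) ?_
  simp only [Finset.mem_filter, Finset.mem_powerset]
  refine ⟨fun a ha => ?_, hA⟩
  simp only [Finset.mem_filter, Finset.mem_Icc]
  exact ⟨⟨Nat.one_le_iff_ne_zero.2 (hs a ha).1, hk a ha⟩, hs a ha⟩

theorem exists_card_eq_smoothMax (ps : List ℕ) (k : ℕ) :
    ∃ A : Finset ℕ, HasPropertyP 3 3 A ∧ (∀ a ∈ A, IsSmooth ps a) ∧ (∀ a ∈ A, a ≤ k) ∧
      A.card = smoothMax ps k := by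
  classical
  have hne : ((((Finset.Icc 1 k).filter (IsSmooth ps)).powerset.filter
      (HasPropertyP 3 3))).Nonempty := by
    refine ⟨∅, ?_⟩
    simp only [Finset.mem_filter, Finset.mem_powerset, Finset.empty_subset, true_and]
    rw [hasPropertyP_three_iff]
    simp
  obtain ⟨A, hA, h⟩ := Finset.exists_mem_eq_sup _ hne Finset.card
  simp only [Finset.mem_filter, Finset.mem_powerset] at hA
  refine ⟨A, hA.2, fun a ha => ?_, fun a ha => ?_, ?_⟩
  · exact (Finset.mem_filter.1 (hA.1 ha)).2
  · exact (Finset.mem_Icc.1 (Finset.mem_filter.1 (hA.1 ha)).1).2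
  · rw [smoothMax, h]

theorem smoothMax_mono (ps : List ℕ) : Monotone (smoothMax ps) := by
  intro k l hkl
  obtain ⟨A, h1, h2, h3, h4⟩ := exists_card_eq_smoothMax ps k
  rw [← h4]
  exact le_smoothMax h1 h2 fun a ha => (h3 a ha).trans hkl

theorem smoothMax_zero (ps : List ℕ) : smoothMax ps 0 = 0 := by
  obtain ⟨A, h1, h2, h3, h4⟩ := exists_card_eq_smoothMax ps 0
  rw [← h4, Finset.card_eq_zero, Finset.eq_empty_iff_forall_notMem]
  intro a ha
  exact (h2 a ha).1 (Nat.le_zero.1 (h3 a ha))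

/-- There are only finitely many exponent classes, so sets of smooth numbers with the property have
bounded size. -/
theorem smoothMax_le (ps : List ℕ) (k : ℕ) : smoothMax ps k ≤ 2 * 3 ^ ps.length := by
  obtain ⟨A, h1, h2, h3, h4⟩ := exists_card_eq_smoothMax ps k
  rw [← h4]
  have := Finset.card_le_mul_card_image_of_maps_to (s := A) (t := Finset.range (3 ^ ps.length))
    (f := code ps) (fun a _ => Finset.mem_range.2 (code_lt ps a)) 2
    (fun x _ => card_code_fiber_le h1 h2 x)
  simpa using this

/-! ### Splitting off the smooth part -/

theorem mem_of_prime_dvd_prod {ps : List ℕ} (hp : ∀ p ∈ ps, p.Prime) {q : ℕ} (hq : q.Prime)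
    (h : q ∣ ps.prod) : q ∈ ps := by
  obtain ⟨p, hpm, hqp⟩ := (hq.prime.dvd_prod_iff).1 h
  rwa [(Nat.prime_dvd_prime_iff_eq hq (hp p hpm)).1 hqp]

theorem IsSmooth.coprime {ps : List ℕ} {s m : ℕ} (hs : IsSmooth ps s)
    (hm : ps.prod.Coprime m) : s.Coprime m := by
  refine Nat.Coprime.symm (Nat.coprime_of_dvd fun q hq hqm hqs => ?_)
  have h1 : q ∣ ps.prod := List.dvd_prod (hs.2 q hq hqs)
  exact hq.one_lt.ne' (Nat.dvd_one.1 (hm ▸ Nat.dvd_gcd h1 hqm))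

theorem exists_smooth_mul_coprime {ps : List ℕ} (hp : ∀ p ∈ ps, p.Prime) {a : ℕ} (ha : a ≠ 0) :
    ∃ s m, IsSmooth ps s ∧ ps.prod.Coprime m ∧ a = s * m := by
  induction a using Nat.recOnMul with
  | zero => exact absurd rfl ha
  | one =>
    refine ⟨1, 1, ⟨one_ne_zero, fun q hq h => ?_⟩, Nat.coprime_one_right _, rfl⟩
    exact absurd (Nat.dvd_one.1 h) hq.one_lt.ne'
  | prime q hq =>
    by_cases hqp : q ∈ ps
    · refine ⟨q, 1, ⟨hq.ne_zero, fun r hr h => ?_⟩, Nat.coprime_one_right _, (mul_one q).symm⟩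
      rwa [(Nat.prime_dvd_prime_iff_eq hr hq).1 h]
    · refine ⟨1, q, ⟨one_ne_zero, fun r hr h => ?_⟩, ?_, (one_mul q).symm⟩
      · exact absurd (Nat.dvd_one.1 h) hr.one_lt.ne'
      · exact ((Nat.Prime.coprime_iff_not_dvd hq).2
          fun h => hqp (mem_of_prime_dvd_prod hp hq h)).symm
  | mul x y hx hy =>
    obtain ⟨s, m, h1, h2, h3⟩ := hx (left_ne_zero_of_mul ha)
    obtain ⟨t, l, h4, h5, h6⟩ := hy (right_ne_zero_of_mul ha)
    refine ⟨s * t, m * l, ⟨mul_ne_zero h1.1 h4.1, fun q hq h => ?_⟩,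
      Nat.Coprime.mul_right h2 h5, by rw [h3, h6]; ring⟩
    rcases (hq.dvd_mul).1 h with h | h
    · exact h1.2 q hq h
    · exact h4.2 q hq h

theorem eq_of_smooth_mul_eq {ps : List ℕ} {s t m l : ℕ} (hs : IsSmooth ps s) (ht : IsSmooth ps t)
    (hm : ps.prod.Coprime m) (hl : ps.prod.Coprime l) (h : s * m = t * l) : m = l := by
  apply Nat.dvd_antisymm
  · exact (ht.coprime hm).symm.dvd_of_dvd_mul_left (h ▸ Dvd.intro_left s rfl)
  · exact (hs.coprime hl).symm.dvd_of_dvd_mul_left (h ▸ Dvd.intro_left t rfl)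

theorem le_maxSizeF {n : ℕ} {A : Finset ℕ} (hA : HasPropertyP 3 3 A)
    (h : A ⊆ Finset.Icc 1 n) : A.card ≤ maxSizeF 3 3 n := by
  classical
  unfold maxSizeF
  refine Finset.le_sup (f := Finset.card) ?_
  simp only [Finset.mem_filter, Finset.mem_powerset]
  exact ⟨h, hA⟩

theorem exists_card_eq_maxSizeF (n : ℕ) :
    ∃ A : Finset ℕ, HasPropertyP 3 3 A ∧ A ⊆ Finset.Icc 1 n ∧ A.card = maxSizeF 3 3 n := by
  classical
  have hne : ((Finset.Icc 1 n).powerset.filter (HasPropertyP 3 3)).Nonempty := by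
    refine ⟨∅, ?_⟩
    simp only [Finset.mem_filter, Finset.mem_powerset, Finset.empty_subset, true_and]
    rw [hasPropertyP_three_iff]
    simp
  obtain ⟨A, hA, h⟩ := Finset.exists_mem_eq_sup _ hne Finset.card
  simp only [Finset.mem_filter, Finset.mem_powerset] at hA
  exact ⟨A, hA.2, hA.1, by rw [maxSizeF, h]⟩

/-- The multiples `m * s ∈ A` of a fixed rough number `m` by smooth numbers `s` give a set of smooth
numbers with the property. -/
theorem maxSizeF_le_sum {ps : List ℕ} (hp : ∀ p ∈ ps, p.Prime) (n : ℕ) :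
    maxSizeF 3 3 n ≤ ∑ m ∈ (Finset.Icc 1 n).filter (ps.prod.Coprime ·), smoothMax ps (n / m) := by
  classical
  obtain ⟨A, hA, hAn, hcard⟩ := exists_card_eq_maxSizeF n
  set B : ℕ → Finset ℕ := fun m =>
    (Finset.Icc 1 (n / m)).filter fun s => IsSmooth ps s ∧ s * m ∈ A with hB
  have hsub : A ⊆ ((Finset.Icc 1 n).filter (ps.prod.Coprime ·)).biUnion
      fun m => (B m).image (· * m) := by
    intro a ha
    have han := Finset.mem_Icc.1 (hAn ha)
    obtain ⟨s, m, hs, hm, rfl⟩ := exists_smooth_mul_coprime hp (a := a) (by omega)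
    have hm0 : 0 < m := Nat.pos_of_ne_zero (by rintro rfl; simp at han)
    have hs0 : 0 < s := Nat.pos_of_ne_zero hs.1
    simp only [Finset.mem_biUnion, Finset.mem_filter, Finset.mem_Icc, Finset.mem_image, hB]
    refine ⟨m, ⟨⟨hm0, (Nat.le_mul_of_pos_left m hs0).trans han.2⟩, hm⟩, s,
      ⟨⟨hs0, (Nat.le_div_iff_mul_le hm0).2 han.2⟩, hs, ha⟩, rfl⟩
  rw [← hcard]
  refine (Finset.card_le_card hsub).trans (Finset.card_biUnion_le.trans ?_)
  refine Finset.sum_le_sum fun m hm => Finset.card_image_le.trans ?_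
  have hm0 : m ≠ 0 := by
    have := (Finset.mem_Icc.1 (Finset.mem_filter.1 hm).1).1
    omega
  refine le_smoothMax ?_ (fun s hs => (Finset.mem_filter.1 hs).2.1)
    fun s hs => (Finset.mem_Icc.1 (Finset.mem_filter.1 hs).1).2
  refine hasPropertyP_of_forall (fun s hs => (Finset.mem_filter.1 hs).2.1.1) ?_
  intro a ha b hb c hc hab hac hbc h
  simp only [hB, Finset.mem_filter] at ha hb hc
  have h1 := ha.2.1.1
  have h2 := hb.2.1.1
  have h3 := hc.2.1.1
  obtain ⟨p, hp⟩ := hA.exists_factorization ha.2.2 hb.2.2 hc.2.2 (mul_ne_zero h1 hm0)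
    (mul_ne_zero h2 hm0) (mul_ne_zero h3 hm0)
    (fun h => hab (Nat.eq_of_mul_eq_mul_right (Nat.pos_of_ne_zero hm0) h))
    (fun h => hac (Nat.eq_of_mul_eq_mul_right (Nat.pos_of_ne_zero hm0) h))
    (fun h => hbc (Nat.eq_of_mul_eq_mul_right (Nat.pos_of_ne_zero hm0) h))
  apply hp
  rw [Nat.factorization_mul h1 hm0, Nat.factorization_mul h2 hm0, Nat.factorization_mul h3 hm0]
  simp only [Finsupp.add_apply]
  have := h p
  omega

/-- If a product of three numbers `s * m` with `s` smooth and `m` rough and square-free is a cube,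
then the rough parts agree, since every prime divides all of them or none. Hence optimal smooth sets
may be chosen independently for the different `m`. -/
theorem sum_le_maxSizeF {ps : List ℕ} (hp : ∀ p ∈ ps, p.Prime) (n : ℕ) :
    ∑ m ∈ (Finset.Icc 1 n).filter (fun m => ps.prod.Coprime m ∧ Squarefree m),
      smoothMax ps (n / m) ≤ maxSizeF 3 3 n := by
  classical
  choose S hS1 hS2 hS3 hS4 using exists_card_eq_smoothMax ps
  set I := (Finset.Icc 1 n).filter (fun m => ps.prod.Coprime m ∧ Squarefree m) with hI
  set A : Finset ℕ := I.biUnion fun m => (S (n / m)).image (· * m) with hA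
  have hcard : A.card = ∑ m ∈ I, smoothMax ps (n / m) := by
    rw [hA, Finset.card_biUnion]
    · refine Finset.sum_congr rfl fun m hm => ?_
      have hm0 : 0 < m := (Finset.mem_Icc.1 (Finset.mem_filter.1 hm).1).1
      rw [Finset.card_image_of_injective _ (fun x y h => Nat.eq_of_mul_eq_mul_right hm0 h), hS4]
    · intro m hm l hl hml
      rw [Function.onFun, Finset.disjoint_left]
      intro a ha ha'
      obtain ⟨s, hs, rfl⟩ := Finset.mem_image.1 ha
      obtain ⟨t, ht, h⟩ := Finset.mem_image.1 ha'
      exact hml (eq_of_smooth_mul_eq (hS2 _ s hs) (hS2 _ t ht) (Finset.mem_filter.1 hm).2.1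
        (Finset.mem_filter.1 hl).2.1 h.symm)
  rw [← hcard]
  have hmem : ∀ a ∈ A, ∃ m s, ps.prod.Coprime m ∧ Squarefree m ∧ 0 < m ∧ s ∈ S (n / m) ∧
      a = s * m := by
    intro a ha
    obtain ⟨m, hm, ha⟩ := Finset.mem_biUnion.1 ha
    obtain ⟨s, hs, rfl⟩ := Finset.mem_image.1 ha
    have h := Finset.mem_filter.1 hm
    exact ⟨m, s, h.2.1, h.2.2, (Finset.mem_Icc.1 h.1).1, hs, rfl⟩
  refine le_maxSizeF (hasPropertyP_of_forall ?_ ?_) ?_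
  · intro a ha
    obtain ⟨m, s, -, -, hm, hs, rfl⟩ := hmem a ha
    exact mul_ne_zero (hS2 _ s hs).1 hm.ne'
  · intro a ha b hb c hc hab hac hbc h
    obtain ⟨m₁, s₁, c₁, q₁, p₁, t₁, rfl⟩ := hmem a ha
    obtain ⟨m₂, s₂, c₂, q₂, p₂, t₂, rfl⟩ := hmem b hb
    obtain ⟨m₃, s₃, c₃, q₃, p₃, t₃, rfl⟩ := hmem c hc
    have z₁ := (hS2 _ _ t₁)
    have z₂ := (hS2 _ _ t₂)
    have z₃ := (hS2 _ _ t₃)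
    have hfac : ∀ p, 3 ∣ (s₁.factorization p + m₁.factorization p) +
        (s₂.factorization p + m₂.factorization p) +
        (s₃.factorization p + m₃.factorization p) := by
      intro p
      have := h p
      rwa [Nat.factorization_mul z₁.1 p₁.ne', Nat.factorization_mul z₂.1 p₂.ne',
        Nat.factorization_mul z₃.1 p₃.ne'] at this
    have hsm : ∀ p, p ∉ ps → ∀ s, IsSmooth ps s → s.factorization p = 0 := by
      intro p hpp s hs
      by_cases hpr : p.Prime
      · exact Nat.factorization_eq_zero_of_not_dvd fun h => hpp (hs.2 p hpr h)
      · exact Nat.factorization_eq_zero_of_not_prime _ hpr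
    have hrough : ∀ p ∈ ps, ∀ m, ps.prod.Coprime m → m.factorization p = 0 := by
      intro p hpp m hm
      refine Nat.factorization_eq_zero_of_not_dvd fun h => ?_
      exact (hp p hpp).one_lt.ne' (Nat.dvd_one.1 (hm ▸ Nat.dvd_gcd (List.dvd_prod hpp) h))
    have heq : ∀ p, m₁.factorization p = m₂.factorization p ∧
        m₂.factorization p = m₃.factorization p := by
      intro p
      by_cases hpp : p ∈ ps
      · simp [hrough p hpp _ c₁, hrough p hpp _ c₂, hrough p hpp _ c₃]
      · have := hfac p
        rw [hsm p hpp _ z₁, hsm p hpp _ z₂, hsm p hpp _ z₃] at this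
        have := q₁.natFactorization_le_one p
        have := q₂.natFactorization_le_one p
        have := q₃.natFactorization_le_one p
        omega
    have h12 : m₁ = m₂ := Nat.eq_of_factorization_eq p₁.ne' p₂.ne' fun p => (heq p).1
    have h23 : m₂ = m₃ := Nat.eq_of_factorization_eq p₂.ne' p₃.ne' fun p => (heq p).2
    subst h12 h23
    obtain ⟨p, hp'⟩ := (hS1 _).exists_factorization t₁ t₂ t₃ z₁.1 z₂.1 z₃.1
      (fun h => hab (by rw [h])) (fun h => hac (by rw [h])) (fun h => hbc (by rw [h]))
    have := hfac p
    omega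
  · intro a ha
    obtain ⟨m, s, -, -, hm, hs, rfl⟩ := hmem a ha
    rw [Finset.mem_Icc]
    exact ⟨Nat.mul_pos (Nat.pos_of_ne_zero (hS2 _ s hs).1) hm,
      (Nat.le_div_iff_mul_le hm).1 (hS3 _ s hs)⟩

/-! ### Densities from step functions -/

/-- The number of positive integers up to `x` coprime to `N`. -/
def coprimeCount (N x : ℕ) : ℕ := ((Finset.Icc 1 x).filter (N.Coprime ·)).card

/-- The number of entries of `b` not exceeding `k`: a step function given by its jumps. -/
def stepCount (b : List ℕ) (k : ℕ) : ℕ := (b.filter (· ≤ k)).length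

theorem Icc_one_eq_Ico (x : ℕ) : Finset.Icc 1 x = Finset.Ico 1 (1 + x) := by
  ext a; simp only [Finset.mem_Icc, Finset.mem_Ico]; omega

theorem coprimeCount_le {N : ℕ} (hN : 0 < N) (x : ℕ) :
    coprimeCount N x ≤ N.totient * (x / N + 1) := by
  rw [coprimeCount, Icc_one_eq_Ico]
  exact Nat.Ico_filter_coprime_le 1 x hN.ne'

theorem le_coprimeCount (N x : ℕ) : N.totient * (x / N) ≤ coprimeCount N x := by
  have key : ∀ q : ℕ, ((Finset.Icc 1 (N * q)).filter (N.Coprime ·)).card = N.totient * q := by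
    intro q
    induction q with
    | zero => simp
    | succ q ih =>
      have hsplit : Finset.Icc 1 (N * (q + 1)) =
          Finset.Icc 1 (N * q) ∪ Finset.Ico (N * q + 1) (N * q + 1 + N) := by
        ext a
        simp only [Finset.mem_union, Finset.mem_Icc, Finset.mem_Ico, mul_add, mul_one]
        omega
      rw [hsplit, Finset.filter_union, Finset.card_union_of_disjoint, ih,
        Nat.filter_coprime_Ico_eq_totient]
      · ring
      · refine Finset.disjoint_filter_filter ?_
        rw [Finset.disjoint_left]
        intro a ha hb
        simp only [Finset.mem_Icc, Finset.mem_Ico] at ha hb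
        omega
  rw [← key, coprimeCount]
  refine Finset.card_le_card (Finset.filter_subset_filter _ (Finset.Icc_subset_Icc le_rfl ?_))
  exact Nat.mul_div_le x N

theorem abs_coprimeCount_sub_le {N : ℕ} (hN : 0 < N) (x : ℕ) :
    |(coprimeCount N x : ℝ) - N.totient / N * x| ≤ N := by
  have h1 : (coprimeCount N x : ℝ) ≤ N.totient * ((x / N : ℕ) + 1) := by
    exact_mod_cast coprimeCount_le hN x
  have h2 : (N.totient : ℝ) * (x / N : ℕ) ≤ coprimeCount N x := by
    exact_mod_cast le_coprimeCount N x
  have h3 : (N.totient : ℝ) ≤ N := by exact_mod_cast Nat.totient_le N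
  have h4 : ((x / N : ℕ) : ℝ) ≤ x / N := Nat.cast_div_le
  have h5 : (x : ℝ) / N ≤ (x / N : ℕ) + 1 := by
    rw [div_le_iff₀ (by exact_mod_cast hN)]
    have := Nat.lt_div_mul_add (a := x) hN
    have h : x ≤ (x / N + 1) * N := by rw [add_mul]; omega
    exact_mod_cast h
  have h6 : (N.totient : ℝ) / N * x = N.totient * (x / N) := by ring
  rw [abs_le, h6]
  have h0 : (0 : ℝ) ≤ N.totient := by positivity
  constructor <;> nlinarith

theorem stepCount_cons (x : ℕ) (b : List ℕ) (k : ℕ) :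
    stepCount (x :: b) k = (if x ≤ k then 1 else 0) + stepCount b k := by
  unfold stepCount
  rw [List.filter_cons]
  split_ifs <;> simp_all [add_comm]

/-- Counting the pairs of a jump `x` and an `m ∈ I` with `x ≤ n / m` in the other order. -/
theorem sum_stepCount {b : List ℕ} (hb : ∀ x ∈ b, 0 < x) (n : ℕ) (P : ℕ → Prop)
    [DecidablePred P] :
    ∑ m ∈ (Finset.Icc 1 n).filter P, stepCount b (n / m) =
      (b.map fun x => ((Finset.Icc 1 (n / x)).filter P).card).sum := by
  induction b with
  | nil => simp [stepCount]
  | cons x b ih =>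
    have hx : 0 < x := hb x (by simp)
    simp only [stepCount_cons, Finset.sum_add_distrib, List.map_cons, List.sum_cons]
    rw [ih fun y hy => hb y (by simp [hy])]
    congr 1
    rw [← Finset.card_filter, Finset.filter_filter]
    congr 1
    ext m
    simp only [Finset.mem_filter, Finset.mem_Icc]
    constructor
    · rintro ⟨⟨h1, h2⟩, h3, h4⟩
      exact ⟨⟨h1, (Nat.le_div_iff_mul_le hx).2
        (by rw [mul_comm]; exact (Nat.le_div_iff_mul_le (by omega)).1 h4)⟩, h3⟩
    · rintro ⟨⟨h1, h2⟩, h3⟩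
      have := (Nat.le_div_iff_mul_le hx).1 h2
      exact ⟨⟨h1, (Nat.le_mul_of_pos_right m hx).trans this⟩, h3,
        (Nat.le_div_iff_mul_le (by omega)).2 (by rw [mul_comm]; exact this)⟩

/-- The sum of the inverse squares of the integers `d ≥ 2` coprime to `N`. -/
noncomputable def invSqTail (N : ℕ) : ℝ :=
  ∑' d : ℕ, if 2 ≤ d ∧ N.Coprime d then 1 / (d : ℝ) ^ 2 else 0

theorem summable_ite_one_div_sq (P : ℕ → Prop) [DecidablePred P] :
    Summable fun d : ℕ => if P d then 1 / (d : ℝ) ^ 2 else 0 := by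
  refine Summable.of_nonneg_of_le (fun d => ?_) (fun d => ?_)
    (Real.summable_one_div_nat_pow.2 (by norm_num : 1 < 2))
  · split_ifs <;> positivity
  · split_ifs
    · exact le_rfl
    · positivity

theorem summable_invSqTail (N : ℕ) :
    Summable fun d : ℕ => if 2 ≤ d ∧ N.Coprime d then 1 / (d : ℝ) ^ 2 else 0 :=
  summable_ite_one_div_sq fun d => 2 ≤ d ∧ N.Coprime d

theorem invSqTail_nonneg (N : ℕ) : 0 ≤ invSqTail N :=
  tsum_nonneg fun d => by split_ifs <;> positivity

/-- A number that is not square-free is divisible by some `d ^ 2` with `d ≥ 2`. -/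
theorem coprimeCount_le_squarefree (N x : ℕ) :
    coprimeCount N x ≤ ((Finset.Icc 1 x).filter fun m => N.Coprime m ∧ Squarefree m).card +
      ∑ d ∈ (Finset.Icc 2 x.sqrt).filter (N.Coprime ·), coprimeCount N (x / d ^ 2) := by
  classical
  set D := (Finset.Icc 2 x.sqrt).filter (N.Coprime ·) with hD
  have hsub : (Finset.Icc 1 x).filter (N.Coprime ·) ⊆
      ((Finset.Icc 1 x).filter fun m => N.Coprime m ∧ Squarefree m) ∪
        D.biUnion fun d => ((Finset.Icc 1 (x / d ^ 2)).filter (N.Coprime ·)).image (d ^ 2 * ·) := by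
    intro m hm
    simp only [Finset.mem_filter, Finset.mem_Icc] at hm
    by_cases hsq : Squarefree m
    · exact Finset.mem_union_left _ (Finset.mem_filter.2 ⟨Finset.mem_Icc.2 hm.1, hm.2, hsq⟩)
    · refine Finset.mem_union_right _ ?_
      unfold Squarefree at hsq
      push Not at hsq
      obtain ⟨d, ⟨k, hk⟩, hd⟩ := hsq
      have hd1 : d ≠ 1 := by simpa using hd
      have hk0 : 0 < k := Nat.pos_of_ne_zero (by rintro rfl; simp at hk; omega)
      have hd0 : 0 < d := Nat.pos_of_ne_zero (by rintro rfl; simp at hk; omega)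
      have hNd : N.Coprime d := Nat.Coprime.coprime_dvd_right ⟨d * k, by rw [hk]; ring⟩ hm.2
      have hNk : N.Coprime k := Nat.Coprime.coprime_dvd_right ⟨d * d, by rw [hk]; ring⟩ hm.2
      simp only [Finset.mem_biUnion, Finset.mem_image, Finset.mem_filter, Finset.mem_Icc, hD]
      refine ⟨d, ⟨⟨by omega, ?_⟩, hNd⟩, k, ⟨⟨hk0, ?_⟩, hNk⟩, by rw [hk]; ring⟩
      · rw [Nat.le_sqrt]
        exact (Nat.le_mul_of_pos_right _ hk0).trans (hk ▸ hm.1.2)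
      · rw [Nat.le_div_iff_mul_le (by positivity)]
        calc k * d ^ 2 = m := by rw [hk]; ring
          _ ≤ x := hm.1.2
  calc coprimeCount N x ≤ _ := Finset.card_le_card hsub
    _ ≤ _ := Finset.card_union_le _ _
    _ ≤ _ := by
      gcongr
      refine Finset.card_biUnion_le.trans (Finset.sum_le_sum fun d _ => Finset.card_image_le)

/-- The square-free numbers coprime to `N` have density at least `φ(N) / N * (1 - invSqTail N)`. This
is not sharp, but the defect tends to zero as `N` grows. -/
theorem le_card_squarefree {N : ℕ} (hN : 0 < N) (x : ℕ) :
    N.totient / N * (1 - invSqTail N) * x - N * (x.sqrt + 1) ≤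
      (((Finset.Icc 1 x).filter fun m => N.Coprime m ∧ Squarefree m).card : ℝ) := by
  have h := coprimeCount_le_squarefree N x
  have h1 := (abs_le.1 (abs_coprimeCount_sub_le hN x)).1
  set c : ℝ := N.totient / N with hc
  have hc0 : 0 ≤ c := by positivity
  have h2 : ((∑ d ∈ (Finset.Icc 2 x.sqrt).filter (N.Coprime ·), coprimeCount N (x / d ^ 2) : ℕ) : ℝ)
      ≤ c * x * invSqTail N + N * x.sqrt := by
    push_cast
    calc ∑ d ∈ (Finset.Icc 2 x.sqrt).filter (N.Coprime ·), (coprimeCount N (x / d ^ 2) : ℝ)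
        ≤ ∑ d ∈ (Finset.Icc 2 x.sqrt).filter (N.Coprime ·), (c * x * (1 / (d : ℝ) ^ 2) + N) := by
          refine Finset.sum_le_sum fun d hd => ?_
          have h3 := (abs_le.1 (abs_coprimeCount_sub_le hN (x / d ^ 2))).2
          have h4 : ((x / d ^ 2 : ℕ) : ℝ) ≤ x / (d : ℝ) ^ 2 := by
            exact_mod_cast (Nat.cast_div_le : ((x / d ^ 2 : ℕ) : ℝ) ≤ _)
          have h5 : c * ((x / d ^ 2 : ℕ) : ℝ) ≤ c * (x / (d : ℝ) ^ 2) := by gcongr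
          have h6 : c * x * (1 / (d : ℝ) ^ 2) = c * (x / (d : ℝ) ^ 2) := by ring
          rw [h6]
          linarith
      _ = c * x * ∑ d ∈ (Finset.Icc 2 x.sqrt).filter (N.Coprime ·), 1 / (d : ℝ) ^ 2 +
            ((Finset.Icc 2 x.sqrt).filter (N.Coprime ·)).card * N := by
          rw [Finset.sum_add_distrib, ← Finset.mul_sum, Finset.sum_const, nsmul_eq_mul]
      _ ≤ c * x * invSqTail N + x.sqrt * N := by
          gcongr
          · calc ∑ d ∈ (Finset.Icc 2 x.sqrt).filter (N.Coprime ·), 1 / (d : ℝ) ^ 2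
                = ∑ d ∈ (Finset.Icc 2 x.sqrt).filter (N.Coprime ·),
                    (if 2 ≤ d ∧ N.Coprime d then 1 / (d : ℝ) ^ 2 else 0) := by
                  refine Finset.sum_congr rfl fun d hd => ?_
                  rw [Finset.mem_filter, Finset.mem_Icc] at hd
                  rw [if_pos ⟨hd.1.1, hd.2⟩]
              _ ≤ invSqTail N := (summable_invSqTail N).sum_le_tsum _
                  fun d _ => by split_ifs <;> positivity
          · refine (Finset.card_filter_le _ _).trans ?_
            rw [Nat.card_Icc]; omega
      _ = _ := by ring
  have h3 : (coprimeCount N x : ℝ) ≤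
      (((Finset.Icc 1 x).filter fun m => N.Coprime m ∧ Squarefree m).card : ℝ) +
      ((∑ d ∈ (Finset.Icc 2 x.sqrt).filter (N.Coprime ·), coprimeCount N (x / d ^ 2) : ℕ) : ℝ) := by
    exact_mod_cast h
  nlinarith

theorem tendsto_natDiv_div {x : ℕ} (hx : 0 < x) :
    Tendsto (fun n : ℕ => ((n / x : ℕ) : ℝ) / n) atTop (𝓝 (1 / x)) := by
  have h1 : Tendsto (fun n : ℕ => (1 : ℝ) / x - 1 / n) atTop (𝓝 (1 / x)) := by
    simpa using tendsto_const_nhds.sub (tendsto_one_div_atTop_nhds_zero_nat (𝕜 := ℝ))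
  refine tendsto_of_tendsto_of_tendsto_of_le_of_le' h1 tendsto_const_nhds ?_ ?_
  all_goals
    filter_upwards [eventually_gt_atTop 0] with n hn
    have hn' : (0 : ℝ) < n := by exact_mod_cast hn
    have hx' : (0 : ℝ) < x := by exact_mod_cast hx
  · rw [le_div_iff₀ hn', sub_mul, one_div_mul_cancel hn'.ne', div_mul_eq_mul_div, one_mul,
      sub_le_iff_le_add, div_le_iff₀ hx']
    have := Nat.lt_div_mul_add (a := n) hx
    have h : n ≤ (n / x + 1) * x := by rw [add_mul]; omega
    exact_mod_cast h
  · rw [div_le_iff₀ hn', one_div_mul_eq_div]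
    exact Nat.cast_div_le

theorem tendsto_sum_map_list {b : List ℕ} {f : ℕ → ℕ → ℝ} {g : ℕ → ℝ}
    (h : ∀ x ∈ b, Tendsto (f x) atTop (𝓝 (g x))) :
    Tendsto (fun n => (b.map fun x => f x n).sum) atTop (𝓝 (b.map g).sum) := by
  induction b with
  | nil => simp
  | cons x b ih =>
    simp only [List.map_cons, List.sum_cons]
    exact (h x (by simp)).add (ih fun y hy => h y (by simp [hy]))

/-- An upper bound of `smoothMax ps` by a step function gives an upper bound for
`maxSizeF 3 3 n / n` with an explicit limit. -/
theorem exists_tendsto_ge {ps : List ℕ} (hp : ∀ p ∈ ps, p.Prime) {b : List ℕ}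
    (hb : ∀ x ∈ b, 0 < x) (h : ∀ k, smoothMax ps k ≤ stepCount b k) :
    ∃ u : ℕ → ℝ, Tendsto u atTop
        (𝓝 (ps.prod.totient / ps.prod * (b.map fun x : ℕ => 1 / (x : ℝ)).sum)) ∧
      ∀ n : ℕ, (maxSizeF 3 3 n : ℝ) / n ≤ u n := by
  have hN : 0 < ps.prod := List.prod_pos fun p hpm => (hp p hpm).pos
  set N := ps.prod
  refine ⟨fun n => (b.map fun x =>
    (N.totient : ℝ) / N * (((n / x : ℕ) : ℝ) / n) + N * (1 / (n : ℝ))).sum, ?_, ?_⟩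
  · rw [← List.sum_map_mul_left]
    refine tendsto_sum_map_list fun x hx => ?_
    have := ((tendsto_natDiv_div (hb x hx)).const_mul ((N.totient : ℝ) / N)).add
      ((tendsto_one_div_atTop_nhds_zero_nat (𝕜 := ℝ)).const_mul (N : ℝ))
    simpa using this
  · intro n
    have h1 : maxSizeF 3 3 n ≤ (b.map fun x => coprimeCount N (n / x)).sum := by
      refine (maxSizeF_le_sum hp n).trans ?_
      simp only [coprimeCount]
      rw [← sum_stepCount hb n (fun m => N.Coprime m)]
      exact Finset.sum_le_sum fun m _ => h _
    calc (maxSizeF 3 3 n : ℝ) / n ≤ ((b.map fun x => coprimeCount N (n / x)).sum : ℕ) / n := by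
          gcongr
      _ = (b.map fun x => (coprimeCount N (n / x) : ℝ) / n).sum := by
          rw [Nat.cast_list_sum, List.map_map]
          simp only [div_eq_mul_inv]
          rw [← List.sum_map_mul_right]
          rfl
      _ ≤ _ := by
          refine List.sum_le_sum fun x hx => ?_
          have h3 := (abs_le.1 (abs_coprimeCount_sub_le hN (n / x))).2
          calc (coprimeCount N (n / x) : ℝ) / n
              ≤ ((N.totient : ℝ) / N * (n / x : ℕ) + N) / n := by
                gcongr; linarith
            _ = _ := by ring

/-- A lower bound of `smoothMax ps` by a step function gives a lower bound for
`maxSizeF 3 3 n / n` with an explicit limit. -/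
theorem exists_tendsto_le {ps : List ℕ} (hp : ∀ p ∈ ps, p.Prime) {b : List ℕ}
    (hb : ∀ x ∈ b, 0 < x) (h : ∀ k, stepCount b k ≤ smoothMax ps k) :
    ∃ u : ℕ → ℝ, Tendsto u atTop (𝓝 ((1 - invSqTail ps.prod) *
        (ps.prod.totient / ps.prod * (b.map fun x : ℕ => 1 / (x : ℝ)).sum))) ∧
      ∀ n : ℕ, u n ≤ (maxSizeF 3 3 n : ℝ) / n := by
  have hN : 0 < ps.prod := List.prod_pos fun p hpm => (hp p hpm).pos
  set N := ps.prod
  set σ := invSqTail N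
  have hsqrt : Tendsto (fun n : ℕ => ((n.sqrt : ℝ) + 1) / n) atTop (𝓝 0) := by
    have h0 : Tendsto (fun n : ℕ => (1 : ℝ) / √n + 1 / n) atTop (𝓝 0) := by
      have h1 : Tendsto (fun n : ℕ => √(n : ℝ)) atTop atTop :=
        Real.tendsto_sqrt_atTop.comp tendsto_natCast_atTop_atTop
      have h2 : Tendsto (fun n : ℕ => (1 : ℝ) / √n) atTop (𝓝 0) := by
        simpa [one_div, Function.comp_def] using tendsto_inv_atTop_zero.comp h1
      simpa using h2.add (tendsto_one_div_atTop_nhds_zero_nat (𝕜 := ℝ))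
    refine squeeze_zero (fun n => by positivity) (fun n => ?_) h0
    rw [add_div]
    refine add_le_add ?_ le_rfl
    rcases Nat.eq_zero_or_pos n with rfl | hn
    · simp
    · have hn' : (0 : ℝ) < n := by exact_mod_cast hn
      rw [div_le_div_iff₀ hn' (by positivity), one_mul]
      calc (n.sqrt : ℝ) * √n ≤ √n * √n := by gcongr; exact Real.nat_sqrt_le_real_sqrt
        _ = n := Real.mul_self_sqrt hn'.le
  refine ⟨fun n => (b.map fun x =>
    (N.totient : ℝ) / N * (1 - σ) * (((n / x : ℕ) : ℝ) / n) - N * (((n.sqrt : ℝ) + 1) / n)).sum,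
    ?_, ?_⟩
  · rw [← List.sum_map_mul_left, ← List.sum_map_mul_left]
    refine tendsto_sum_map_list fun x hx => ?_
    have := ((tendsto_natDiv_div (hb x hx)).const_mul ((N.totient : ℝ) / N * (1 - σ))).sub
      (hsqrt.const_mul (N : ℝ))
    rw [mul_zero, sub_zero] at this
    convert this using 2
    ring
  · intro n
    have h1 : (b.map fun x => ((Finset.Icc 1 (n / x)).filter
        fun m => N.Coprime m ∧ Squarefree m).card).sum ≤ maxSizeF 3 3 n := by
      refine le_trans ?_ (sum_le_maxSizeF hp n)
      rw [← sum_stepCount hb n (fun m => N.Coprime m ∧ Squarefree m)]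
      exact Finset.sum_le_sum fun m _ => h _
    calc _ ≤ (b.map fun x => ((((Finset.Icc 1 (n / x)).filter
            fun m => N.Coprime m ∧ Squarefree m).card : ℕ) : ℝ) / n).sum := by
          refine List.sum_le_sum fun x hx => ?_
          have h3 := le_card_squarefree hN (n / x)
          have h4 : (((n / x).sqrt : ℕ) : ℝ) ≤ n.sqrt := by
            exact_mod_cast Nat.sqrt_le_sqrt (Nat.div_le_self n x)
          calc _ = ((N.totient : ℝ) / N * (1 - σ) * (n / x : ℕ) - N * ((n.sqrt : ℝ) + 1)) / n := by
                ring
            _ ≤ ((N.totient : ℝ) / N * (1 - σ) * (n / x : ℕ) - N * (((n / x).sqrt : ℝ) + 1)) / n := by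
                gcongr
            _ ≤ _ := by gcongr
      _ = (((b.map fun x => ((Finset.Icc 1 (n / x)).filter
            fun m => N.Coprime m ∧ Squarefree m).card).sum : ℕ) : ℝ) / n := by
          rw [Nat.cast_list_sum, List.map_map]
          simp only [div_eq_mul_inv]
          rw [← List.sum_map_mul_right]
          rfl
      _ ≤ _ := by gcongr

/-! ### Existence of the limit -/

/-- A bounded nondecreasing function on `ℕ` vanishing at zero is a step function. -/
theorem exists_stepCount_eq {f : ℕ → ℕ} (hf : Monotone f) (h0 : f 0 = 0) {J : ℕ}
    (hJ : ∀ k, f k ≤ J) : ∃ b : List ℕ, (∀ x ∈ b, 0 < x) ∧ ∀ k, f k = stepCount b k := by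
  induction J generalizing f with
  | zero => exact ⟨[], by simp, fun k => by simpa [stepCount] using hJ k⟩
  | succ J ih =>
    obtain ⟨b, hb, hfb⟩ := ih (f := fun k => min (f k) J)
      (fun k l hkl => min_le_min_right J (hf hkl)) (by simp [h0]) fun k => min_le_right _ _
    by_cases h : ∃ k, f k = J + 1
    · classical
      have hk0 : 0 < Nat.find h := by
        rw [Nat.find_pos]
        omega
      refine ⟨Nat.find h :: b, List.forall_mem_cons.2 ⟨hk0, hb⟩, fun k => ?_⟩
      rw [stepCount_cons, ← hfb k]
      have hk := hJ k
      split_ifs with hle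
      · have := hf hle
        rw [Nat.find_spec h] at this
        omega
      · have : f k ≠ J + 1 := fun hk => hle (Nat.find_min' h hk)
        omega
    · push Not at h
      refine ⟨b, hb, fun k => ?_⟩
      rw [← hfb k]
      have := hJ k
      have := h k
      omega

/-- The primes below `K`. -/
def primesBelowList (K : ℕ) : List ℕ := (List.range K).filter (fun p => p.Prime)

theorem mem_primesBelowList {K p : ℕ} : p ∈ primesBelowList K ↔ p < K ∧ p.Prime := by
  simp [primesBelowList]

theorem invSqTail_le {N K : ℕ} (h : ∀ d, 2 ≤ d → N.Coprime d → K ≤ d) :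
    invSqTail N ≤ ∑' d : ℕ, 1 / ((d + K : ℕ) : ℝ) ^ 2 := by
  have hs : Summable fun d : ℕ => 1 / (d : ℝ) ^ 2 :=
    Real.summable_one_div_nat_pow.2 (by norm_num : 1 < 2)
  have h0 : ∑ d ∈ Finset.range K, (if 2 ≤ d ∧ N.Coprime d then 1 / (d : ℝ) ^ 2 else 0) = 0 :=
    Finset.sum_eq_zero fun d hd =>
      if_neg fun hd' => (h d hd'.1 hd'.2).not_gt (Finset.mem_range.1 hd)
  have heq := (summable_invSqTail N).sum_add_tsum_nat_add K
  rw [h0, zero_add] at heq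
  refine heq.symm.le.trans (Summable.tsum_le_tsum (fun d => ?_)
    ((summable_nat_add_iff (f := fun d : ℕ => if 2 ≤ d ∧ N.Coprime d then 1 / (d : ℝ) ^ 2 else 0)
      K).2 (summable_invSqTail N)) ((summable_nat_add_iff K).2 hs))
  split_ifs
  · exact le_rfl
  · positivity

theorem tendsto_invSqTail_primesBelow :
    Tendsto (fun K => invSqTail (primesBelowList K).prod) atTop (𝓝 0) := by
  have ht := tendsto_sum_nat_add fun d : ℕ => 1 / (d : ℝ) ^ 2
  refine squeeze_zero (fun K => invSqTail_nonneg _) (fun K => invSqTail_le fun d h2 h => ?_) ht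
  by_contra! hd
  have hp := Nat.minFac_prime (n := d) (by omega)
  have hmem : d.minFac ∈ primesBelowList K :=
    mem_primesBelowList.2 ⟨(Nat.minFac_le (by omega)).trans_lt hd, hp⟩
  exact hp.one_lt.ne' (Nat.dvd_one.1 (h ▸ Nat.dvd_gcd (List.dvd_prod hmem) d.minFac_dvd))

/-- A sequence between convergent sequences with arbitrarily close limits converges. -/
theorem exists_tendsto_of_squeeze {u : ℕ → ℝ}
    (h : ∀ ε > 0, ∃ (v w : ℕ → ℝ) (l L : ℝ), Tendsto v atTop (𝓝 l) ∧ Tendsto w atTop (𝓝 L) ∧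
      (∀ n, v n ≤ u n) ∧ (∀ n, u n ≤ w n) ∧ L - l ≤ ε) : ∃ C, Tendsto u atTop (𝓝 C) := by
  refine cauchySeq_tendsto_of_complete (Metric.cauchySeq_iff'.2 fun ε hε => ?_)
  obtain ⟨v, w, l, L, hv, hw, hvu, huw, hL⟩ := h (ε / 4) (by positivity)
  obtain ⟨M, hM⟩ := eventually_atTop.1 ((hv.eventually (lt_mem_nhds (show l - ε / 4 < l by linarith))).and
    (hw.eventually (gt_mem_nhds (show L < L + ε / 4 by linarith))))
  refine ⟨M, fun n hn => ?_⟩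
  have h1 := hM n hn
  have h2 := hM M le_rfl
  rw [Real.dist_eq, abs_lt]
  constructor <;> linarith [hvu n, hvu M, huw n, huw M]

theorem maxSizeF_le (n : ℕ) : maxSizeF 3 3 n ≤ n := by
  obtain ⟨A, -, hA, hcard⟩ := exists_card_eq_maxSizeF n
  rw [← hcard]
  simpa using Finset.card_le_card hA

theorem exists_tendsto_maxSizeF_div :
    ∃ C : ℝ, Tendsto (fun n : ℕ => (maxSizeF 3 3 n : ℝ) / (n : ℝ)) atTop (𝓝 C) := by
  refine exists_tendsto_of_squeeze fun ε hε => ?_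
  obtain ⟨K, hK⟩ := (tendsto_invSqTail_primesBelow.eventually
    (gt_mem_nhds (show (0 : ℝ) < min (1 / 2) (ε / 2) by positivity))).exists
  obtain ⟨hK1, hK2⟩ := lt_min_iff.1 hK
  set ps := primesBelowList K
  have hp : ∀ p ∈ ps, p.Prime := fun p h => (mem_primesBelowList.1 h).2
  obtain ⟨b, hb, hbs⟩ := exists_stepCount_eq (smoothMax_mono ps) (smoothMax_zero ps)
    (smoothMax_le ps)
  obtain ⟨w, hw, huw⟩ := exists_tendsto_ge hp hb fun k => (hbs k).le
  obtain ⟨v, hv, hvu⟩ := exists_tendsto_le hp hb fun k => (hbs k).ge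
  refine ⟨v, w, _, _, hv, hw, hvu, huw, ?_⟩
  set σ := invSqTail ps.prod
  set L : ℝ := ps.prod.totient / ps.prod * (b.map fun x : ℕ => 1 / (x : ℝ)).sum
  -- this bounds `L` by `2`, so the gap `σ * L` is at most `ε`
  have hL : (1 - σ) * L ≤ 1 := by
    refine le_of_tendsto' hv fun n => (hvu n).trans ?_
    refine div_le_one_of_le₀ ?_ (by positivity)
    exact_mod_cast maxSizeF_le n
  have hσ : 0 ≤ σ := invSqTail_nonneg _
  nlinarith

/-! ### Branch and bound for caps -/

/-- Application `f n`, arranged so that the kernel evaluates `n` to a numeral before substituting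
it: the recursor only reduces once its major premise is in normal form. -/
def force (f : ℕ → Bool) (n : ℕ) : Bool :=
  Nat.rec (motive := fun _ => Bool) (f 0) (fun n _ => f (Nat.succ n)) n

theorem force_eq (f : ℕ → Bool) (n : ℕ) : force f n = f n := by
  cases n <;> rfl

/-- The values `f 0, …, f (n - 1)` packed into one number, seven bits each. -/
def pack : (ℕ → ℕ) → ℕ → ℕ
  | _, 0 => 0
  | f, n + 1 => Nat.add (f 0) (Nat.mul 128 (pack (fun i => f (Nat.succ i)) n))

theorem pack_shiftRight_mod {n : ℕ} {f : ℕ → ℕ} (hf : ∀ i, f i < 128) {s : ℕ} (hs : s < n) :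
    (pack f n >>> (7 * s)) % 128 = f s := by
  induction n generalizing f s with
  | zero => omega
  | succ n ih =>
    have h0 := hf 0
    have hpack : pack f (n + 1) = f 0 + 128 * pack (fun i => f (i + 1)) n := rfl
    rw [hpack]
    cases s with
    | zero => simp; omega
    | succ s =>
      rw [← ih (fun i => hf (i + 1)) (by omega : s < n), Nat.shiftRight_eq_div_pow,
        Nat.shiftRight_eq_div_pow, mul_add, pow_add, mul_comm (2 ^ _), ← Nat.div_div_eq_div_mul]
      congr 2
      norm_num
      omega

/-- The row of `c` in the table of `third`, packed. -/
def thirdRow (c : ℕ) : ℕ := pack (third 4 c) 81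

theorem thirdRow_shiftRight_mod (c : ℕ) {s : ℕ} (hs : s < 81) :
    (thirdRow c >>> (7 * s)) % 128 = third 4 c s :=
  pack_shiftRight_mod (fun i => (third_lt 4 c i).trans (by norm_num)) hs

/-- The list of pairs `(c, thirdRow c)` for `c ∈ L`, with all rows evaluated, passed on to `k`. -/
def withRows : List ℕ → (List (ℕ × ℕ) → Bool) → Bool
  | [], k => k []
  | c :: L, k => force (fun r => withRows L fun l => k ((c, r) :: l)) (thirdRow c)

theorem withRows_eq (L : List ℕ) (k : List (ℕ × ℕ) → Bool) :
    withRows L k = k (L.map fun c => (c, thirdRow c)) := by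
  induction L generalizing k with
  | nil => rfl
  | cons c L ih => rw [withRows, force_eq, ih]; rfl

/-- `F` together with the bits of the third points on the lines through the point with row `row`
and the points of `S`; the points of `S` are stored multiplied by seven. -/
def addThirds (row : ℕ) : List ℕ → ℕ → ℕ
  | [], F => F
  | s :: S, F => addThirds row S (Nat.lor F (Nat.shiftLeft 1 (Nat.mod (Nat.shiftRight row s) 128)))

/-- Continue with `k U` unless the bound `bd U` is already below `T`. -/
def prune (bd : ℕ → ℕ) (T : ℕ) (k : ℕ → Bool) (U : ℕ) : Bool :=
  force (fun V => cond (Nat.ble T (bd V)) (k V) true) U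

/-- Branch and bound over the caps consisting of the points `S` already taken and some points of
the list whose bits are set in `U`. At each point of the list the cap either contains it, and then
the third points on its lines to `S` are removed from `U`, or it does not. The value is `true` only
if each branch ends with a bound `bd` smaller than `T`. -/
def search (bd : ℕ → ℕ) (T : ℕ) (L : List (ℕ × ℕ)) : List ℕ → ℕ → Bool :=
  List.rec (motive := fun _ => List ℕ → ℕ → Bool) (fun _ _ => false)
    (fun p _ ih S U =>
      cond (Nat.beq (Nat.land (Nat.shiftRight U p.1) 1) 0) (ih S U)
       (cond (prune bd T (ih (Nat.mul 7 p.1 :: S)) (Nat.xor U (Nat.land U (addThirds p.2 S 0))))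
        (prune bd T (ih S) (Nat.xor U (Nat.shiftLeft 1 p.1))) false)) L

theorem search_cons (bd : ℕ → ℕ) (T p row : ℕ) (L : List (ℕ × ℕ)) (S : List ℕ) (U : ℕ) :
    search bd T ((p, row) :: L) S U =
      cond (Nat.beq (Nat.land (Nat.shiftRight U p) 1) 0) (search bd T L S U)
        (cond (prune bd T (search bd T L (7 * p :: S)) (U ^^^ (U &&& addThirds row S 0)))
          (prune bd T (search bd T L S) (U ^^^ (1 <<< p))) false) := rfl

theorem testBit_addThirds {row : ℕ} {S : List ℕ} {F c : ℕ} :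
    (addThirds row S F).testBit c = true ↔
      F.testBit c = true ∨ ∃ s ∈ S, c = (row >>> s) % 128 := by
  induction S generalizing F with
  | nil => simp [addThirds]
  | cons s S ih =>
    have h : addThirds row (s :: S) F = addThirds row S (F ||| 1 <<< ((row >>> s) % 128)) := rfl
    rw [h, ih]
    simp only [Nat.testBit_or, Nat.one_shiftLeft, Nat.testBit_two_pow, Bool.or_eq_true,
      decide_eq_true_eq, List.mem_cons, exists_eq_or_imp, or_assoc]
    simp only [eq_comm]

theorem prune_sound {bd : ℕ → ℕ} {T U m : ℕ} {k : ℕ → Bool} (h : prune bd T k U = true)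
    (hbd : m ≤ bd U) (hk : k U = true → m < T) : m < T := by
  rw [prune, force_eq] at h
  rcases hb : Nat.ble T (bd U) with _ | _
  · have : ¬ T ≤ bd U := fun h => by rw [Nat.ble_eq_true_of_le h] at hb; cases hb
    omega
  · rw [hb] at h
    exact hk h

/-- Here `Q` is a class of caps of `(ℤ/3)^4` and `w` a weight on it which is bounded by `bd U` on the
caps contained in the set of bits of `U`. -/
theorem search_sound {Q : Finset ℕ → Prop} {w : Finset ℕ → ℕ} {bd : ℕ → ℕ} {T : ℕ}
    (hcap : ∀ C, Q C → IsCap 4 C ∧ ∀ c ∈ C, c < 81)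
    (hbd : ∀ C U, Q C → (∀ c ∈ C, U.testBit c = true) → w C ≤ bd U)
    {L : List ℕ} (hL : L.Nodup) {S : List ℕ} {U : ℕ}
    (h : search bd T (L.map fun c => (c, thirdRow c)) S U = true)
    {C : Finset ℕ} (hC : Q C) (hU : ∀ c ∈ C, U.testBit c = true)
    (hS : ∀ s ∈ S, ∃ c ∈ C, c ∉ L ∧ s = 7 * c) : w C < T := by
  induction L generalizing S U with
  | nil => exact absurd h (by simp [search])
  | cons p L ih =>
    rw [List.nodup_cons] at hL
    have hS' : ∀ s ∈ S, ∃ c ∈ C, c ∉ L ∧ s = 7 * c := fun s hs => by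
      obtain ⟨c, hc, hcL, rfl⟩ := hS s hs
      exact ⟨c, hc, fun h => hcL (List.mem_cons_of_mem _ h), rfl⟩
    rw [List.map_cons, search_cons] at h
    rcases hb : Nat.beq (Nat.land (Nat.shiftRight U p) 1) 0 with _ | _
    · rw [hb, cond_false, Bool.cond_false_right, Bool.and_eq_true] at h
      by_cases hp : p ∈ C
      · have hU' : ∀ c ∈ C, (U ^^^ (U &&& addThirds (thirdRow p) S 0)).testBit c = true := by
          intro c hc
          have hnot : (addThirds (thirdRow p) S 0).testBit c = false := by
            rw [← Bool.not_eq_true, testBit_addThirds]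
            rintro (h0 | ⟨s, hs, hcs⟩)
            · simp at h0
            · obtain ⟨d, hd, hdL, rfl⟩ := hS s hs
              rw [thirdRow_shiftRight_mod p ((hcap C hC).2 d hd)] at hcs
              exact (hcap C hC).1 p hp d hd (fun h => hdL (h ▸ List.mem_cons_self)) (hcs ▸ hc)
          simp [Nat.testBit_xor, Nat.testBit_and, hU c hc, hnot]
        refine prune_sound h.1 (hbd C _ hC hU') fun h1 => ih hL.2 h1 hU' ?_
        intro s hs
        rcases List.mem_cons.1 hs with rfl | hs
        · exact ⟨p, hp, hL.1, rfl⟩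
        · exact hS' s hs
      · have hU' : ∀ c ∈ C, (U ^^^ (1 <<< p)).testBit c = true := by
          intro c hc
          have hcp : p ≠ c := fun h => hp (h ▸ hc)
          simp [Nat.testBit_xor, hU c hc, Nat.one_shiftLeft, hcp]
        exact prune_sound h.2 (hbd C _ hC hU') fun h1 => ih hL.2 h1 hU' hS'
    · rw [hb, cond_true] at h
      exact ih hL.2 h hU hS'

/-! ### Layers of caps -/

/-- The part of `C` with leading digits `q`, projected to the last `r` digits. -/
def layer (r : ℕ) (C : Finset ℕ) (q : ℕ) : Finset ℕ :=
  (C.filter (· / 3 ^ r = q)).image (· % 3 ^ r)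

theorem mem_layer {r : ℕ} {C : Finset ℕ} {q a : ℕ} :
    a ∈ layer r C q ↔ a < 3 ^ r ∧ 3 ^ r * q + a ∈ C := by
  have h3 : 0 < 3 ^ r := by positivity
  simp only [layer, Finset.mem_image, Finset.mem_filter]
  constructor
  · rintro ⟨c, ⟨hc, rfl⟩, rfl⟩
    exact ⟨Nat.mod_lt _ h3, by rwa [Nat.div_add_mod]⟩
  · rintro ⟨ha, hc⟩
    refine ⟨_, ⟨hc, ?_⟩, ?_⟩
    · rw [Nat.mul_add_div h3, Nat.div_eq_of_lt ha, add_zero]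
    · rw [Nat.mul_add_mod, Nat.mod_eq_of_lt ha]

theorem card_layer (r : ℕ) (C : Finset ℕ) (q : ℕ) :
    (layer r C q).card = (C.filter (· / 3 ^ r = q)).card := by
  refine Finset.card_image_of_injOn fun a ha b hb h => ?_
  have ha' := (Finset.mem_filter.1 ha).2
  have hb' := (Finset.mem_filter.1 hb).2
  have h : a % 3 ^ r = b % 3 ^ r := h
  rw [← Nat.div_add_mod a (3 ^ r), ← Nat.div_add_mod b (3 ^ r), h, ha', hb']

theorem sum_card_layer {r s : ℕ} {C : Finset ℕ} (hC : ∀ c ∈ C, c < 3 ^ (s + r)) :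
    ∑ q ∈ Finset.range (3 ^ s), (layer r C q).card = C.card := by
  simp only [card_layer]
  refine (Finset.card_eq_sum_card_fiberwise fun c hc => ?_).symm
  rw [Finset.mem_coe, Finset.mem_range, Nat.div_lt_iff_lt_mul (by positivity), ← pow_add]
  exact hC c hc

theorem third_add {r s q : ℕ} (hq : q < 3 ^ s) {a b : ℕ} (ha : a < 3 ^ r) (hb : b < 3 ^ r) :
    third (s + r) (3 ^ r * q + a) (3 ^ r * q + b) = 3 ^ r * q + third r a b := by
  induction r generalizing a b with
  | zero =>
    have ha0 : a = 0 := by simpa using ha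
    have hb0 : b = 0 := by simpa using hb
    subst ha0 hb0
    simpa [third] using third_self hq
  | succ r ih =>
    rw [pow_succ] at ha hb
    have := ih (a := a / 3) (b := b / 3) (by omega) (by omega)
    have e : ∀ c, (3 ^ (r + 1) * q + c) % 3 = c % 3 := fun c => by rw [pow_succ]; lia
    have e' : ∀ c, (3 ^ (r + 1) * q + c) / 3 = 3 ^ r * q + c / 3 := fun c => by
      rw [show 3 ^ (r + 1) * q = 3 * (3 ^ r * q) by ring]; omega
    rw [← add_assoc]
    simp only [third, e, e', this]
    ring

theorem IsCap.layer {r s : ℕ} {C : Finset ℕ} (hC : IsCap (s + r) C) {q : ℕ} (hq : q < 3 ^ s) :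
    IsCap r (layer r C q) := by
  intro a ha b hb hab h
  rw [mem_layer] at ha hb h
  refine hC _ ha.2 _ hb.2 (by omega) ?_
  rw [third_add hq ha.1 hb.1]
  exact h.2

theorem rep_append {ps qs : List ℕ} {q a : ℕ} (ha : a < 3 ^ ps.length) :
    rep (ps ++ qs) (3 ^ ps.length * q + a) = rep ps a * rep qs q := by
  induction ps generalizing a with
  | nil => simp at ha; simp [rep, ha]
  | cons p ps ih =>
    rw [List.length_cons, pow_succ] at ha
    have e : (3 ^ (ps.length + 1) * q + a) % 3 = a % 3 := by rw [pow_succ]; lia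
    have e' : (3 ^ (ps.length + 1) * q + a) / 3 = 3 ^ ps.length * q + a / 3 := by
      rw [show 3 ^ (ps.length + 1) * q = 3 * (3 ^ ps.length * q) by ring]; omega
    rw [List.cons_append, List.length_cons, rep, rep, e, e', ih (by omega)]
    ring

instance decidableIsCap (r : ℕ) (C : Finset ℕ) : Decidable (IsCap r C) := by unfold IsCap; infer_instance

theorem card_le_of_isCap_two {C : Finset ℕ} (hC : IsCap 2 C) (h : ∀ c ∈ C, c < 9) : C.card ≤ 4 := by
  have key : ∀ D ∈ (Finset.range 9).powerset, IsCap 2 D → D.card ≤ 4 := by decide +kernel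
  exact key C (Finset.mem_powerset.2 fun c hc => Finset.mem_range.2 (h c hc)) hC

/-- The numbers `min 4 k`, three bits each, where `k` is the number of binary digits one of
`v = 0, …, 511`. -/
def planeTable : ℕ := 0x9249249249249249249249249249249249249249249249239249249249249249249249239249249249239249239238da9249249249249249249249239249249249239249239238da9249249249239249239238da9249239238da9238da8da6919249249249249249249249239249249249239249239238da9249249249239249239238da9249239238da9238da8da6919249249249239249239238da9249239238da9238da8da6919249239238da9238da8da6919238da8da6918da691691448

theorem planeTable_shiftRight_mod : ∀ v < 512, (planeTable >>> (3 * v)) % 8 =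
    min 4 ((Finset.range 9).filter (v.testBit ·)).card := by decide +kernel

/-- Bound for the number of points of a cap in the plane of the codes `k, …, k + 8`. -/
def planeBound (U k : ℕ) : ℕ :=
  Nat.mod (Nat.shiftRight planeTable (Nat.mul 3 (Nat.mod (Nat.shiftRight U k) 512))) 8

/-- Bound for the number of points of a cap among the codes `k, …, k + 26`, given the bound `R`. -/
def layerBound (R U k : ℕ) : ℕ :=
  Nat.sub R (Nat.sub R (Nat.add (Nat.add (planeBound U k) (planeBound U (Nat.add k 9)))
    (planeBound U (Nat.add k 18))))

/-- Bound for a cap contained in the set of bits of `U`, given bounds for its three layers. -/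
def capBound (R₀ R₁ R₂ U : ℕ) : ℕ :=
  Nat.add (Nat.add (layerBound R₀ U 0) (layerBound R₁ U 27)) (layerBound R₂ U 54)

theorem sub_sub_eq_min (a b : ℕ) : Nat.sub a (Nat.sub a b) = min a b := by
  change a - (a - b) = min a b
  omega

theorem card_layer_two_le {C : Finset ℕ} (hC : IsCap 4 C) {U : ℕ}
    (hU : ∀ c ∈ C, U.testBit c = true) {q : ℕ} (hq : q < 9) :
    (layer 2 C q).card ≤ planeBound U (9 * q) := by
  have h : planeBound U (9 * q) = (planeTable >>> (3 * ((U >>> (9 * q)) % 512))) % 8 := rfl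
  rw [h, planeTable_shiftRight_mod _ (Nat.mod_lt _ (by norm_num))]
  refine le_min (card_le_of_isCap_two (hC.layer (s := 2) hq) fun c hc => (mem_layer.1 hc).1)
    (Finset.card_le_card fun a ha => ?_)
  obtain ⟨ha, hac⟩ := mem_layer.1 ha
  norm_num at ha hac
  have := hU _ hac
  rw [Finset.mem_filter, Finset.mem_range, show 512 = 2 ^ 9 by norm_num, Nat.testBit_mod_two_pow,
    Nat.testBit_shiftRight, this]
  simpa using ha

theorem card_le_capBound {C : Finset ℕ} (hC : IsCap 4 C) (hlt : ∀ c ∈ C, c < 81) {U : ℕ}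
    (hU : ∀ c ∈ C, U.testBit c = true) {R₀ R₁ R₂ : ℕ} (h0 : (layer 3 C 0).card ≤ R₀)
    (h1 : (layer 3 C 1).card ≤ R₁) (h2 : (layer 3 C 2).card ≤ R₂) :
    C.card ≤ capBound R₀ R₁ R₂ U := by
  have hsum := sum_card_layer (r := 3) (s := 1) (C := C) (by simpa using hlt)
  have hl : ∀ l < 3, ∀ R, (layer 3 C l).card ≤ R →
      (layer 3 C l).card ≤ layerBound R U (27 * l) := by
    intro l hl R hR
    rw [layerBound, sub_sub_eq_min]
    refine le_min hR ?_
    rw [← sum_card_layer (r := 2) (s := 1) (C := layer 3 C l) fun a ha => (mem_layer.1 ha).1]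
    have e : ∀ q < 3, layer 2 (layer 3 C l) q = layer 2 C (3 * l + q) := by
      intro q hq
      ext a
      simp only [mem_layer, ← and_assoc]
      norm_num
      constructor
      · rintro ⟨⟨h1, h2⟩, h3⟩
        exact ⟨h1, by convert h3 using 1; ring⟩
      · rintro ⟨h1, h3⟩
        exact ⟨⟨h1, by omega⟩, by convert h3 using 1; ring⟩
    rw [show 3 ^ 1 = 3 by norm_num, Finset.sum_range_succ, Finset.sum_range_succ,
      Finset.sum_range_one, e 0 (by norm_num), e 1 (by norm_num), e 2 (by norm_num)]
    have p0 := card_layer_two_le hC hU (q := 3 * l + 0) (by omega)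
    have p1 := card_layer_two_le hC hU (q := 3 * l + 1) (by omega)
    have p2 := card_layer_two_le hC hU (q := 3 * l + 2) (by omega)
    rw [show 9 * (3 * l + 0) = 27 * l by ring] at p0
    rw [show 9 * (3 * l + 1) = 27 * l + 9 by ring] at p1
    rw [show 9 * (3 * l + 2) = 27 * l + 18 by ring] at p2
    exact add_le_add (add_le_add p0 p1) p2
  rw [show 3 ^ 1 = 3 by norm_num, Finset.sum_range_succ, Finset.sum_range_succ,
    Finset.sum_range_one] at hsum
  rw [← hsum]
  exact add_le_add (add_le_add (hl 0 (by norm_num) _ h0) (hl 1 (by norm_num) _ h1))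
    (hl 2 (by norm_num) _ h2)

/-! ### Caps in dimensions three and four have at most nine and twenty points -/

/-- The value at `x` of the linear functional on `(ℤ/3)^r` whose coefficients are the ternary digits
of `f`. -/
def dot : ℕ → ℕ → ℕ → ℕ
  | 0, _, _ => 0
  | r + 1, f, x => (f % 3 * (x % 3) + dot r (f / 3) (x / 3)) % 3

theorem dot_succ (r f x : ℕ) :
    dot (r + 1) f x = (f % 3 * (x % 3) + dot r (f / 3) (x / 3)) % 3 := rfl

theorem dot_lt (r f x : ℕ) : dot r f x < 3 := by
  cases r <;> simp only [dot] <;> omega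

theorem dot_third (r f x y : ℕ) :
    dot r f (third r x y) = (6 - dot r f x - dot r f y) % 3 := by
  induction r generalizing f x y with
  | zero => simp [dot]
  | succ r ih =>
    have h1 := dot_lt r (f / 3) (x / 3)
    have h2 := dot_lt r (f / 3) (y / 3)
    have e : third (r + 1) x y % 3 = (6 - x % 3 - y % 3) % 3 := by simp only [third]; omega
    have e' : third (r + 1) x y / 3 = third r (x / 3) (y / 3) := by simp only [third]; omega
    simp only [dot, e, e', ih]
    have hf : f % 3 < 3 := Nat.mod_lt _ (by norm_num)
    have hx : x % 3 < 3 := Nat.mod_lt _ (by norm_num)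
    have hy : y % 3 < 3 := Nat.mod_lt _ (by norm_num)
    generalize dot r (f / 3) (x / 3) = a at *
    generalize dot r (f / 3) (y / 3) = b at *
    generalize f % 3 = c at *
    generalize x % 3 = d at *
    generalize y % 3 = e at *
    interval_cases c <;> omega

/-- The digitwise difference of two points of `(ℤ/3)^r`. -/
def digitSub : ℕ → ℕ → ℕ → ℕ
  | 0, _, _ => 0
  | r + 1, x, y => (x % 3 + 2 * (y % 3)) % 3 + 3 * digitSub r (x / 3) (y / 3)

theorem digitSub_lt (r x y : ℕ) : digitSub r x y < 3 ^ r := by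
  induction r generalizing x y with
  | zero => simp [digitSub]
  | succ r ih =>
    have := ih (x / 3) (y / 3)
    simp only [digitSub, pow_succ]
    omega

theorem eq_of_digitSub_eq_zero {r x y : ℕ} (hx : x < 3 ^ r) (hy : y < 3 ^ r)
    (h : digitSub r x y = 0) : x = y := by
  induction r generalizing x y with
  | zero => simp at hx hy; omega
  | succ r ih =>
    rw [pow_succ] at hx hy
    simp only [digitSub] at h
    have := ih (x := x / 3) (y := y / 3) (by omega) (by omega) (by omega)
    omega

theorem dot_digitSub_eq_zero_iff (r f x y : ℕ) :
    dot r f (digitSub r x y) = 0 ↔ dot r f x = dot r f y := by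
  have key : dot r f (digitSub r x y) = (dot r f x + 2 * dot r f y) % 3 := by
    induction r generalizing f x y with
    | zero => simp [dot]
    | succ r ih =>
      have e : digitSub (r + 1) x y % 3 = (x % 3 + 2 * (y % 3)) % 3 := by
        simp only [digitSub]; omega
      have e' : digitSub (r + 1) x y / 3 = digitSub r (x / 3) (y / 3) := by
        simp only [digitSub]; omega
      simp only [dot, e, e', ih]
      have hf : f % 3 < 3 := Nat.mod_lt _ (by norm_num)
      generalize f % 3 = c at *
      interval_cases c <;> omega
  have h1 := dot_lt r f x
  have h2 := dot_lt r f y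
  omega

theorem third_succ (r x y : ℕ) :
    third (r + 1) x y = (6 - x % 3 - y % 3) % 3 + 3 * third r (x / 3) (y / 3) := rfl

/-- Dropping a coordinate on which `f` depends: the kernel of `f` and its translates are copies
of `(ℤ/3)^r`. -/
theorem exists_projection {r f : ℕ} (hf : f % 3 ^ (r + 1) ≠ 0) : ∃ g : ℕ → ℕ,
    (∀ x < 3 ^ (r + 1), g x < 3 ^ r) ∧ (∀ x y, g (third (r + 1) x y) = third r (g x) (g y)) ∧
      ∀ x y, dot (r + 1) f x = dot (r + 1) f y → g x = g y → x = y := by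
  induction r generalizing f with
  | zero =>
    refine ⟨fun x => x / 3, fun x hx => by simp at hx ⊢; omega,
      fun x y => by simp [third], fun x y h hg => ?_⟩
    have hg : x / 3 = y / 3 := hg
    simp only [dot, add_zero, zero_add, pow_one] at h hf
    have hc : f % 3 < 3 := Nat.mod_lt _ (by norm_num)
    generalize f % 3 = c at *
    interval_cases c <;> omega
  | succ r ih =>
    by_cases h0 : f % 3 = 0
    · have hf' : f / 3 % 3 ^ (r + 1) ≠ 0 := by
        intro h
        apply hf
        rw [pow_succ', Nat.mod_mul, h0, h]
      obtain ⟨g, h1, h2, h3⟩ := ih hf'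
      refine ⟨fun x => x % 3 + 3 * g (x / 3), fun x hx => ?_, fun x y => ?_, fun x y h hg => ?_⟩
      · have := h1 (x / 3) (by rw [pow_succ] at hx; omega)
        rw [pow_succ]
        change x % 3 + 3 * g (x / 3) < _
        omega
      · have e : third (r + 1 + 1) x y % 3 = (6 - x % 3 - y % 3) % 3 := by
          rw [third]; omega
        have e' : third (r + 1 + 1) x y / 3 = third (r + 1) (x / 3) (y / 3) := by
          rw [third]; omega
        have d : ∀ a b, (a % 3 + 3 * b) % 3 = a % 3 := by omega
        have d' : ∀ a b, (a % 3 + 3 * b) / 3 = b := by omega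
        simp only [e, e', h2]
        rw [third_succ r (x % 3 + _), d, d, d', d']
      · change x % 3 + 3 * g (x / 3) = y % 3 + 3 * g (y / 3) at hg
        rw [dot_succ (r + 1), dot_succ (r + 1), h0, zero_mul, zero_mul, zero_add, zero_add,
          Nat.mod_eq_of_lt (dot_lt _ _ _), Nat.mod_eq_of_lt (dot_lt _ _ _)] at h
        have := h3 (x / 3) (y / 3) h (by omega)
        omega
    · refine ⟨fun x => x / 3, fun x hx => by rw [pow_succ] at hx; simp only; omega,
        fun x y => by simp only [third]; omega, fun x y h hg => ?_⟩
      have hg : x / 3 = y / 3 := hg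
      rw [dot_succ (r + 1), dot_succ (r + 1), hg] at h
      have hc : f % 3 < 3 := Nat.mod_lt _ (by norm_num)
      generalize f % 3 = c at *
      interval_cases c <;> omega

/-- A bound for caps of `(ℤ/3)^r` holds for hyperplane sections of caps of `(ℤ/3)^(r + 1)`. -/
theorem card_section_le {r m : ℕ}
    (hm : ∀ D : Finset ℕ, IsCap r D → (∀ d ∈ D, d < 3 ^ r) → D.card ≤ m)
    {C : Finset ℕ} (hC : IsCap (r + 1) C) (hlt : ∀ c ∈ C, c < 3 ^ (r + 1)) {f : ℕ}
    (hf : f % 3 ^ (r + 1) ≠ 0) (i : ℕ) : (C.filter fun x => dot (r + 1) f x = i).card ≤ m := by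
  obtain ⟨g, h1, h2, h3⟩ := exists_projection hf
  rw [← Finset.card_image_of_injOn (f := g)]
  · refine hm _ ?_ ?_
    · intro a ha b hb hab hc
      obtain ⟨x, hx, rfl⟩ := Finset.mem_image.1 ha
      obtain ⟨y, hy, rfl⟩ := Finset.mem_image.1 hb
      obtain ⟨z, hz, hzg⟩ := Finset.mem_image.1 hc
      rw [Finset.mem_filter] at hx hy hz
      have hi := dot_lt (r + 1) f x
      have : z = third (r + 1) x y := by
        refine h3 _ _ ?_ (by rw [hzg, h2])
        rw [dot_third]
        omega
      exact hC x hx.1 y hy.1 (fun h => hab (h ▸ rfl)) (this ▸ hz.1)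
    · intro a ha
      obtain ⟨x, hx, rfl⟩ := Finset.mem_image.1 ha
      exact h1 x (hlt x (Finset.mem_filter.1 hx).1)
  · intro x hx y hy hxy
    refine h3 x y ?_ hxy
    have hx := (Finset.mem_filter.1 hx).2
    have hy := (Finset.mem_filter.1 hy).2
    rw [hx, hy]

/-- One functional from each pair `±f` of nonzero functionals on `(ℤ/3)^r`: those whose last nonzero
coefficient is one. -/
def halfDual (r : ℕ) : Finset ℕ := (Finset.range r).biUnion fun k => Finset.Ico (3 ^ k) (2 * 3 ^ k)

theorem mod_ne_zero_of_mem_halfDual {r f : ℕ} (hf : f ∈ halfDual r) : f % 3 ^ r ≠ 0 := by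
  simp only [halfDual, Finset.mem_biUnion, Finset.mem_range, Finset.mem_Ico] at hf
  obtain ⟨k, hk, h1, h2⟩ := hf
  have h3 : 3 ^ (k + 1) ≤ 3 ^ r := Nat.pow_le_pow_right (by norm_num) hk
  have h4 : 0 < 3 ^ k := by positivity
  rw [pow_succ] at h3
  rw [Nat.mod_eq_of_lt (by omega)]
  omega

theorem card_halfDual_dot_eq {r K : ℕ}
    (hK : ∀ d < 3 ^ r, d ≠ 0 → ((halfDual r).filter fun f => dot r f d = 0).card = K)
    {x y : ℕ} (hx : x < 3 ^ r) (hy : y < 3 ^ r) (hxy : x ≠ y) :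
    ((halfDual r).filter fun f => dot r f x = dot r f y).card = K := by
  rw [← hK (digitSub r x y) (digitSub_lt r x y) fun h => hxy (eq_of_digitSub_eq_zero hx hy h)]
  simp only [dot_digitSub_eq_zero_iff]

theorem sum_card_section (r f : ℕ) (C : Finset ℕ) :
    ∑ i ∈ Finset.range 3, (C.filter fun x => dot r f x = i).card = C.card :=
  (Finset.card_eq_sum_card_fiberwise fun x _ => by simpa using dot_lt r f x).symm

theorem sum_sq_card_section (r f : ℕ) (C : Finset ℕ) :
    ∑ i ∈ Finset.range 3, (C.filter fun x => dot r f x = i).card ^ 2 =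
      ∑ x ∈ C, ∑ y ∈ C, if dot r f x = dot r f y then 1 else 0 := by
  have h : ∀ x ∈ C, (∑ y ∈ C, if dot r f x = dot r f y then 1 else 0) =
      (C.filter fun y => dot r f y = dot r f x).card := fun x _ => by
    rw [Finset.card_filter]
    simp only [eq_comm]
  rw [Finset.sum_congr rfl h, ← Finset.sum_fiberwise_of_maps_to (s := C) (t := Finset.range 3)
    (g := fun x => dot r f x) fun x _ => by simpa using dot_lt r f x]
  refine Finset.sum_congr rfl fun i _ => ?_
  rw [Finset.sum_congr rfl (g := fun _ => (C.filter fun y => dot r f y = i).card), Finset.sum_const,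
    sq, smul_eq_mul]
  intro x hx
  rw [(Finset.mem_filter.1 hx).2]

theorem sum_cube_card_section (r f : ℕ) (C : Finset ℕ) :
    ∑ i ∈ Finset.range 3, (C.filter fun x => dot r f x = i).card ^ 3 =
      ∑ x ∈ C, ∑ y ∈ C, ∑ z ∈ C,
        if dot r f x = dot r f y ∧ dot r f x = dot r f z then 1 else 0 := by
  have h : ∀ x ∈ C, (∑ y ∈ C, ∑ z ∈ C,
      if dot r f x = dot r f y ∧ dot r f x = dot r f z then 1 else 0) =
      (C.filter fun y => dot r f y = dot r f x).card ^ 2 := fun x _ => by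
    rw [sq, Finset.card_filter, Finset.sum_mul_sum]
    refine Finset.sum_congr rfl fun y _ => Finset.sum_congr rfl fun z _ => ?_
    rw [ite_and]
    simp only [eq_comm (a := dot r f x)]
    split_ifs <;> simp
  rw [Finset.sum_congr rfl h, ← Finset.sum_fiberwise_of_maps_to (s := C) (t := Finset.range 3)
    (g := fun x => dot r f x) fun x _ => by simpa using dot_lt r f x]
  refine Finset.sum_congr rfl fun i _ => ?_
  rw [Finset.sum_congr rfl (g := fun _ => (C.filter fun y => dot r f y = i).card ^ 2),
    Finset.sum_const, smul_eq_mul]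
  · ring
  · intro x hx
    rw [(Finset.mem_filter.1 hx).2]

theorem sum_pairs {r K m : ℕ}
    (hK : ∀ d < 3 ^ r, d ≠ 0 → ((halfDual r).filter fun f => dot r f d = 0).card = K)
    {C : Finset ℕ} (hlt : ∀ c ∈ C, c < 3 ^ r) (hm : C.card = m + 1) {x : ℕ} (hx : x ∈ C) :
    ∑ y ∈ C, ((halfDual r).filter fun f => dot r f x = dot r f y).card =
      (halfDual r).card + m * K := by
  rw [← Finset.add_sum_erase C _ hx, Finset.sum_congr rfl (g := fun _ => K), Finset.sum_const,
    Finset.card_erase_of_mem hx, hm]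
  · simp
  · intro y hy
    rw [Finset.mem_erase] at hy
    exact card_halfDual_dot_eq hK (hlt x hx) (hlt y hy.2) hy.1.symm

/-- Counting the pairs of points on a common hyperplane by hyperplanes and by pairs; `K` is the number
of functionals in `halfDual r` that vanish on a given direction. -/
theorem sum_sum_sq {r K m : ℕ}
    (hK : ∀ d < 3 ^ r, d ≠ 0 → ((halfDual r).filter fun f => dot r f d = 0).card = K)
    {C : Finset ℕ} (hlt : ∀ c ∈ C, c < 3 ^ r) (hm : C.card = m + 1) :
    ∑ f ∈ halfDual r, ∑ i ∈ Finset.range 3, (C.filter fun x => dot r f x = i).card ^ 2 =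
      (m + 1) * ((halfDual r).card + m * K) := by
  simp only [sum_sq_card_section]
  rw [Finset.sum_comm, Finset.sum_congr rfl (g := fun _ => (halfDual r).card + m * K),
    Finset.sum_const, hm, smul_eq_mul]
  intro x hx
  rw [Finset.sum_comm, ← sum_pairs hK hlt hm hx]
  simp only [Finset.card_filter]

/-- A cap of `(ℤ/3)^3` has at most nine points. If it had ten, then each plane would contain at most
four of them, so in each of the `13` parallel classes at most `36` ordered pairs of points would lie in a
common plane. But there are `490` such pairs over all classes. -/
theorem card_le_of_isCap_three {C : Finset ℕ} (hC : IsCap 3 C) (hlt : ∀ c ∈ C, c < 3 ^ 3) :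
    C.card ≤ 9 := by
  by_contra! h
  obtain ⟨D, hDC, hD⟩ := Finset.exists_subset_card_eq h
  have hK : ∀ d < 3 ^ 3, d ≠ 0 → ((halfDual 3).filter fun f => dot 3 f d = 0).card = 4 := by
    decide +kernel
  have hcard : (halfDual 3).card = 13 := by decide +kernel
  have sq_le : ∀ a b c : ℕ, a ≤ 4 → b ≤ 4 → c ≤ 4 → a + b + c = 10 →
      a ^ 2 + b ^ 2 + c ^ 2 ≤ 36 := by
    intro a b c ha hb hc h
    interval_cases a <;> interval_cases b <;> interval_cases c <;> omega
  have hlt' : ∀ c ∈ D, c < 3 ^ 3 := fun c hc => hlt c (hDC hc)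
  have hsum := sum_sum_sq hK hlt' (m := 9) hD
  have hle : ∑ f ∈ halfDual 3, ∑ i ∈ Finset.range 3, (D.filter fun x => dot 3 f x = i).card ^ 2 ≤
      ∑ f ∈ halfDual 3, 36 := by
    refine Finset.sum_le_sum fun f hf => ?_
    have hs := sum_card_section 3 f D
    have hn := card_section_le (r := 2) (fun E h1 h2 => card_le_of_isCap_two h1 h2) (hC.mono hDC)
      hlt' (mod_ne_zero_of_mem_halfDual hf)
    have h0 := hn 0
    have h1 := hn 1
    have h2 := hn 2
    simp only [Finset.sum_range_succ, Finset.sum_range_zero, zero_add] at hs ⊢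
    norm_num at h0 h1 h2
    generalize (D.filter fun x => dot 3 f x = 0).card = a at *
    generalize (D.filter fun x => dot 3 f x = 1).card = b at *
    generalize (D.filter fun x => dot 3 f x = 2).card = c at *
    rw [hD] at hs
    exact sq_le a b c h0 h1 h2 hs
  rw [hsum, Finset.sum_const, hcard] at hle
  norm_num at hle

/-- A pair of independent directions is annihilated by four of the functionals in `halfDual 4`: each
functional annihilates one or all four of the directions on the line through them. -/
theorem card_halfDual_dot_eq_eq {x y z : ℕ} (hx : x < 3 ^ 4) (hy : y < 3 ^ 4) (hz : z < 3 ^ 4)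
    (hxy : x ≠ y) (hxz : x ≠ z) (hyz : y ≠ z) (h : third 4 x y ≠ z)
    (hK : ∀ d < 3 ^ 4, d ≠ 0 → ((halfDual 4).filter fun f => dot 4 f d = 0).card = 13)
    (hcard : (halfDual 4).card = 40) :
    ((halfDual 4).filter fun f => dot 4 f x = dot 4 f y ∧ dot 4 f x = dot 4 f z).card = 4 := by
  have e1 := card_halfDual_dot_eq hK hx hy hxy
  have e2 := card_halfDual_dot_eq hK hx hz hxz
  have e3 := card_halfDual_dot_eq hK hy hz hyz
  have e4 := card_halfDual_dot_eq hK (third_lt 4 x y) hz h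
  have key : ((halfDual 4).filter fun f => dot 4 f x = dot 4 f y).card +
      ((halfDual 4).filter fun f => dot 4 f x = dot 4 f z).card +
      ((halfDual 4).filter fun f => dot 4 f y = dot 4 f z).card +
      ((halfDual 4).filter fun f => dot 4 f (third 4 x y) = dot 4 f z).card =
      (halfDual 4).card + 3 *
      ((halfDual 4).filter fun f => dot 4 f x = dot 4 f y ∧ dot 4 f x = dot 4 f z).card := by
    simp only [Finset.card_filter, Finset.card_eq_sum_ones (halfDual 4)]
    rw [← Finset.sum_add_distrib, ← Finset.sum_add_distrib, ← Finset.sum_add_distrib,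
      Finset.mul_sum, ← Finset.sum_add_distrib]
    refine Finset.sum_congr rfl fun f _ => ?_
    rw [dot_third]
    have h1 := dot_lt 4 f x
    have h2 := dot_lt 4 f y
    have h3 := dot_lt 4 f z
    generalize dot 4 f x = a at *
    generalize dot 4 f y = b at *
    generalize dot 4 f z = c at *
    interval_cases a <;> interval_cases b <;> interval_cases c <;> rfl
  omega

/-- A cap of `(ℤ/3)^4` has at most twenty points. Suppose that it has `21` and that the three
hyperplanes of a parallel class meet it in `a`, `b`, `c` points. As these are at most nine,
`a ^ 3 + b ^ 3 + c ^ 3 + 1764 ≥ 19 * (a ^ 2 + b ^ 2 + c ^ 2)` with equality only for `(7, 7, 7)` and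
permutations of `(9, 9, 3)`. Counting pairs and triples of points in a common hyperplane shows that
there is equality on summing over the `40` classes, but then the number of pairs would be `3` modulo
`24` in each class, and it is `6300` in total. -/
theorem card_le_of_isCap_four {C : Finset ℕ} (hC : IsCap 4 C) (hlt : ∀ c ∈ C, c < 3 ^ 4) :
    C.card ≤ 20 := by
  by_contra! h
  obtain ⟨D, hDC, hD⟩ := Finset.exists_subset_card_eq h
  have hK : ∀ d < 3 ^ 4, d ≠ 0 → ((halfDual 4).filter fun f => dot 4 f d = 0).card = 13 := by
    decide +kernel
  have hcard : (halfDual 4).card = 40 := by decide +kernel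
  have hltD : ∀ c ∈ D, c < 3 ^ 4 := fun c hc => hlt c (hDC hc)
  have hCD := hC.mono hDC
  have hsq := sum_sum_sq hK hltD (m := 20) hD
  have hcube : ∑ f ∈ halfDual 4, ∑ i ∈ Finset.range 3, (D.filter fun x => dot 4 f x = i).card ^ 3 =
      49140 := by
    simp only [sum_cube_card_section]
    rw [Finset.sum_comm, Finset.sum_congr rfl (g := fun _ => 2340), Finset.sum_const, hD, smul_eq_mul]
    intro x hx
    rw [Finset.sum_comm, ← Finset.add_sum_erase D _ hx, Finset.sum_comm]
    have hxx : ∑ z ∈ D, ∑ f ∈ halfDual 4,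
        (if dot 4 f x = dot 4 f x ∧ dot 4 f x = dot 4 f z then 1 else 0) = 300 := by
      have := sum_pairs hK hltD (m := 20) hD hx
      rw [hcard] at this
      simp only [true_and, ← Finset.card_filter]
      exact this
    rw [hxx, Finset.sum_congr rfl (g := fun _ => 102), Finset.sum_const,
      Finset.card_erase_of_mem hx, hD, smul_eq_mul]
    intro y hy
    obtain ⟨hyx, hyD⟩ := Finset.mem_erase.1 hy
    have hpair := card_halfDual_dot_eq hK (hltD x hx) (hltD y hyD) hyx.symm
    rw [Finset.sum_comm, ← Finset.add_sum_erase D _ hx, ← Finset.add_sum_erase (D.erase x) _ hy,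
      Finset.sum_congr (s₁ := (D.erase x).erase y) rfl (g := fun _ => 4), Finset.sum_const,
      Finset.card_erase_of_mem hy, Finset.card_erase_of_mem hx, hD]
    · simp only [and_true, and_self, ← Finset.card_filter, hpair]
      rfl
    · intro z hz
      obtain ⟨hzy, hzx, hzD⟩ := by simpa only [Finset.mem_erase] using hz
      rw [← Finset.card_filter]
      exact card_halfDual_dot_eq_eq (hltD x hx) (hltD y hyD) (hltD z hzD) hyx.symm (Ne.symm hzx)
        (Ne.symm hzy) (fun h => hCD x hx y hyD hyx.symm (h ▸ hzD)) hK hcard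
  have hsec : ∀ f ∈ halfDual 4,
      19 * ∑ i ∈ Finset.range 3, (D.filter fun x => dot 4 f x = i).card ^ 2 ≤
        (∑ i ∈ Finset.range 3, (D.filter fun x => dot 4 f x = i).card ^ 3) + 1764 ∧
      (19 * ∑ i ∈ Finset.range 3, (D.filter fun x => dot 4 f x = i).card ^ 2 =
        (∑ i ∈ Finset.range 3, (D.filter fun x => dot 4 f x = i).card ^ 3) + 1764 →
      (∑ i ∈ Finset.range 3, (D.filter fun x => dot 4 f x = i).card ^ 2) % 24 = 3) := by
    intro f hf
    have hs := sum_card_section 4 f D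
    have hn := card_section_le (r := 3) (fun E h1 h2 => card_le_of_isCap_three h1 h2) hCD
      hltD (mod_ne_zero_of_mem_halfDual hf)
    have h0 := hn 0
    have h1 := hn 1
    have h2 := hn 2
    have key : ∀ a < 10, ∀ b < 10, ∀ c < 10, a + b + c = 21 →
        19 * (a ^ 2 + b ^ 2 + c ^ 2) ≤ a ^ 3 + b ^ 3 + c ^ 3 + 1764 ∧
        (19 * (a ^ 2 + b ^ 2 + c ^ 2) = a ^ 3 + b ^ 3 + c ^ 3 + 1764 →
          (a ^ 2 + b ^ 2 + c ^ 2) % 24 = 3) := by decide +kernel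
    simp only [Finset.sum_range_succ, Finset.sum_range_zero, zero_add] at hs ⊢
    exact key _ (Nat.lt_succ_of_le h0) _ (Nat.lt_succ_of_le h1) _ (Nat.lt_succ_of_le h2)
      (hs.trans hD)
  have heq : ∀ f ∈ halfDual 4,
      19 * ∑ i ∈ Finset.range 3, (D.filter fun x => dot 4 f x = i).card ^ 2 =
        (∑ i ∈ Finset.range 3, (D.filter fun x => dot 4 f x = i).card ^ 3) + 1764 := by
    refine (Finset.sum_eq_sum_iff_of_le fun f hf => (hsec f hf).1).1 ?_
    rw [← Finset.mul_sum, hsq, Finset.sum_add_distrib, hcube, Finset.sum_const, hcard]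
    rfl
  have hmod : (∑ f ∈ halfDual 4, ∑ i ∈ Finset.range 3,
      (D.filter fun x => dot 4 f x = i).card ^ 2) % 24 = (∑ f ∈ halfDual 4, 3) % 24 := by
    rw [Finset.sum_nat_mod, Finset.sum_congr rfl fun f hf => (hsec f hf).2 (heq f hf)]
  rw [hsq, Finset.sum_const, hcard] at hmod
  norm_num at hmod

/-! ### The bound for sets of 7-smooth numbers -/

/-- The jumps of a step function bounding the size of a cap of `(ℤ/3)^3` all of whose points
represent `{2, 3, 5}`-smooth numbers up to `y`. -/
def capSteps₃ : List ℕ :=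
  [1, 2, 3, 5, 6, 10, 15, 25, 30]

/-- The jumps of a step function bounding the size of a cap of `(ℤ/3)^4` all of whose points
represent `{2, 3, 5, 7}`-smooth numbers up to `y`. -/
def capSteps₄ : List ℕ :=
  [1, 2, 3, 5, 6, 7, 10, 14, 15, 21, 25, 30, 35, 42, 60, 70, 105, 175, 210, 240]

/-- The jumps of a step function bounding the weight `capWeight [2, 3, 5, 7] C` of every cap `C` of
`(ℤ/3)^4`. -/
def weightSteps : List ℕ :=
  [1, 2, 3, 5, 6, 7, 8, 10, 14, 15, 16, 21, 24, 30, 35, 40, 42, 48, 56, 60, 70, 80, 98, 105,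
   120, 140, 168, 200, 210, 240, 280, 392, 480, 504, 560, 784, 840, 1400, 1680, 1920]

/-- The points of `(ℤ/3)^4`, first by decreasing exponent of `7` and then by decreasing number
represented. The searches for caps of large size are short in this order. -/
def decreasingOrder : List ℕ :=
  [80, 79, 77, 78, 71, 76, 74, 70, 75, 68, 73, 69, 62, 67, 72, 65, 61, 66, 59, 64, 60, 58, 63,
   56, 57, 55, 54, 53, 52, 50, 51, 44, 49, 47, 43, 48, 41, 46, 42, 35, 40, 45, 38, 34, 39, 32,
   37, 33, 31, 36, 29, 30, 28, 27, 26, 25, 23, 24, 17, 22, 20, 16, 21, 14, 19, 15, 8, 13, 18,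
   11, 7, 12, 5, 10, 6, 4, 9, 2, 3, 1, 0]

/-- The points of `(ℤ/3)^4`, first by decreasing exponent of `7` and then by increasing number
represented. The searches for caps of large weight are short in this order. -/
def increasingOrder : List ℕ :=
  [54, 55, 57, 56, 63, 58, 60, 64, 59, 66, 61, 65, 72, 67, 62, 69, 73, 68, 75, 70, 74, 76, 71,
   78, 77, 79, 80, 27, 28, 30, 29, 36, 31, 33, 37, 32, 39, 34, 38, 45, 40, 35, 42, 46, 41, 48,
   43, 47, 49, 44, 51, 50, 52, 53, 0, 1, 3, 2, 9, 4, 6, 10, 5, 12, 7, 11, 18, 13, 8, 15, 19, 14,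
   21, 16, 20, 22, 17, 24, 23, 25, 26]

/-- The set of codes below `n` of numbers up to `y`, as a bit mask. -/
def smoothMask (y : ℕ) : ℕ → ℕ
  | 0 => 0
  | n + 1 => Nat.lor (smoothMask y n)
      (cond (Nat.ble (rep [2, 3, 5, 7] n) y) (Nat.shiftLeft 1 n) 0)

/-- The bounds for the three layers of a cap of points representing numbers up to `y`, evaluated and
passed on to `k`. A point of the layer with exponent `l` of `7` represents `7 ^ l` times a
`{2, 3, 5}`-smooth number, which is at most `y / 7 ^ l`. -/
def withLayerBounds (y : ℕ) (k : ℕ → ℕ → ℕ → Bool) : Bool :=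
  force (fun R₀ => force (fun R₁ => force (fun R₂ => k R₀ R₁ R₂)
    (stepCount capSteps₃ (y / 49))) (stepCount capSteps₃ (y / 7))) (stepCount capSteps₃ y)

/-- Bound for the weight of a cap in the set of bits of `U`. The bits of `V` are the points `c` for which
`8 * rep c` counts, too; `M` and `m` bound the sizes of the cap and of its part in `V`, and the other
parameters bound their layers. -/
def weightBound (M m R₀ R₁ R₂ r₀ r₁ r₂ V U : ℕ) : ℕ :=
  Nat.add (Nat.sub M (Nat.sub M (capBound R₀ R₁ R₂ U)))
    (Nat.sub m (Nat.sub m (capBound r₀ r₁ r₂ (Nat.land U V))))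

/-- Do all caps of `(ℤ/3)^3` of points representing numbers up to `y` have size below `T`? -/
def testCap₃ (L : List (ℕ × ℕ)) (y T : ℕ) : Bool :=
  prune (capBound 27 27 27) T (search (capBound 27 27 27) T L []) (smoothMask y 27)

/-- Do all caps of `(ℤ/3)^4` of points representing numbers up to `y` have size below `T`? -/
def testCap₄ (L : List (ℕ × ℕ)) (y T : ℕ) : Bool :=
  withLayerBounds y fun R₀ R₁ R₂ =>
    prune (capBound R₀ R₁ R₂) T (search (capBound R₀ R₁ R₂) T L []) (smoothMask y 81)

/-- Do all caps of `(ℤ/3)^4` have weight below `T` at `y`? -/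
def testWeight (L : List (ℕ × ℕ)) (y T : ℕ) : Bool :=
  withLayerBounds y fun R₀ R₁ R₂ => withLayerBounds (y / 8) fun r₀ r₁ r₂ =>
    force (fun M => force (fun m => force (fun V =>
      prune (weightBound M m R₀ R₁ R₂ r₀ r₁ r₂ V) T
        (search (weightBound M m R₀ R₁ R₂ r₀ r₁ r₂ V) T L []) (smoothMask y 81))
      (smoothMask (y / 8) 81)) (stepCount capSteps₄ (y / 8))) (stepCount capSteps₄ y)

/-- Does `test` hold just before each jump, for the value after the jump? The first jump goes to
`j`. -/
def testJumps (test : ℕ → ℕ → Bool) : List ℕ → ℕ → Bool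
  | [], _ => true
  | x :: t, j => cond (test (x - 1) j) (testJumps test t (j + 1)) false

theorem testBit_smoothMask {y n c : ℕ} :
    (smoothMask y n).testBit c = true ↔ c < n ∧ rep [2, 3, 5, 7] c ≤ y := by
  induction n with
  | zero => simp [smoothMask]
  | succ n ih =>
    have h : smoothMask y (n + 1) =
        smoothMask y n ||| cond (Nat.ble (rep [2, 3, 5, 7] n) y) (1 <<< n) 0 := rfl
    rw [h, Nat.testBit_or, Bool.or_eq_true, ih]
    rcases hb : Nat.ble (rep [2, 3, 5, 7] n) y with _ | _
    · have : ¬ rep [2, 3, 5, 7] n ≤ y := fun h => by rw [Nat.ble_eq_true_of_le h] at hb; cases hb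
      simp only [cond_false, Nat.zero_testBit, Bool.false_eq_true, or_false]
      constructor
      · rintro ⟨h1, h2⟩
        exact ⟨by omega, h2⟩
      · rintro ⟨h1, h2⟩
        refine ⟨lt_of_le_of_ne (by omega) ?_, h2⟩
        rintro rfl
        exact this h2
    · have := Nat.le_of_ble_eq_true hb
      simp only [cond_true, Nat.one_shiftLeft, Nat.testBit_two_pow, decide_eq_true_eq]
      constructor
      · rintro (⟨h1, h2⟩ | rfl)
        · exact ⟨by omega, h2⟩
        · exact ⟨by omega, this⟩
      · rintro ⟨h1, h2⟩
        rcases eq_or_ne n c with h | h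
        · exact Or.inr h
        · exact Or.inl ⟨by omega, h2⟩

theorem of_testJumps {test : ℕ → ℕ → Bool} {t : List ℕ} {j : ℕ} (h : testJumps test t j = true)
    {i : ℕ} (hi : i < t.length) : test (t[i] - 1) (i + j) = true := by
  induction t generalizing i j with
  | nil => simp at hi
  | cons x t ih =>
    rw [testJumps, Bool.cond_false_right, Bool.and_eq_true] at h
    cases i with
    | zero => simpa using h.1
    | succ i =>
      have := ih h.2 (i := i) (by simpa using hi)
      rw [show i + 1 + j = i + (j + 1) by ring]
      simpa using this

/-- A bound before each jump of a step function is a bound by the step function. -/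
theorem le_stepCount {t : List ℕ} {m y : ℕ} (hlen : m ≤ t.length)
    (h : ∀ i (hi : i < t.length), y < t[i] → m < i + 1) : m ≤ stepCount t y := by
  induction t generalizing m with
  | nil => exact hlen
  | cons x t ih =>
    rw [stepCount_cons]
    split_ifs with hx
    · have := ih (m := m - 1) (by simp at hlen; omega) fun i hi hy => by
        have := h (i + 1) (by simpa using hi) (by simpa using hy)
        omega
      omega
    · have := h 0 (by simp) (by simpa using hx)
      omega

theorem withLayerBounds_eq (y : ℕ) (k : ℕ → ℕ → ℕ → Bool) : withLayerBounds y k =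
    k (stepCount capSteps₃ y) (stepCount capSteps₃ (y / 7)) (stepCount capSteps₃ (y / 49)) := by
  simp only [withLayerBounds, force_eq]

theorem nodup_decreasingOrder : decreasingOrder.Nodup := by decide +kernel

theorem nodup_increasingOrder : increasingOrder.Nodup := by decide +kernel

theorem testJumps_capSteps₃ : (withRows decreasingOrder fun L =>
    testJumps (testCap₃ L) capSteps₃ 1) = true := by decide +kernel

theorem card_le_stepCount₃ {D : Finset ℕ} (hD : IsCap 3 D) {y : ℕ}
    (h : ∀ d ∈ D, d < 27 ∧ rep [2, 3, 5] d ≤ y) : D.card ≤ stepCount capSteps₃ y := by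
  refine le_stepCount (card_le_of_isCap_three hD fun d hd => (h d hd).1) fun i hi hy => ?_
  have htest := testJumps_capSteps₃
  rw [withRows_eq] at htest
  have htest := of_testJumps htest hi
  have hlt : ∀ d ∈ D, d < 81 := fun d hd => (h d hd).1.trans (by norm_num)
  have hcap : IsCap 4 D := by
    intro a ha b hb hab hc
    have := third_add (r := 3) (s := 1) (q := 0) (by norm_num) (h a ha).1 (h b hb).1
    rw [mul_zero, zero_add, zero_add, zero_add] at this
    exact hD a ha b hb hab (this ▸ hc)
  have hU : ∀ d ∈ D, (smoothMask (capSteps₃[i] - 1) 27).testBit d = true := by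
    intro d hd
    have hr := rep_append (ps := [2, 3, 5]) (qs := [7]) (q := 0) (a := d) (h d hd).1
    rw [mul_zero, zero_add] at hr
    have hr' : rep [2, 3, 5, 7] d = rep [2, 3, 5] d * 1 := hr
    rw [testBit_smoothMask, hr', mul_one]
    exact ⟨(h d hd).1, by have := (h d hd).2; omega⟩
  have hbd : ∀ (C : Finset ℕ) (U : ℕ), (IsCap 4 C ∧ ∀ c ∈ C, c < 81) →
      (∀ c ∈ C, U.testBit c = true) → C.card ≤ capBound 27 27 27 U := by
    intro C U hC hCU
    have hl : ∀ l, (layer 3 C l).card ≤ 27 := fun l => by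
      have : layer 3 C l ⊆ Finset.range 27 := fun a ha => Finset.mem_range.2 (mem_layer.1 ha).1
      simpa using Finset.card_le_card this
    exact card_le_capBound hC.1 hC.2 hCU (hl 0) (hl 1) (hl 2)
  exact prune_sound htest (hbd D _ ⟨hcap, hlt⟩ hU) fun hs =>
    search_sound (Q := fun C => IsCap 4 C ∧ ∀ c ∈ C, c < 81) (fun C h => h) hbd
      nodup_decreasingOrder hs ⟨hcap, hlt⟩ hU (by simp)

theorem card_layer_le_stepCount {C : Finset ℕ} (hC : IsCap 4 C) {y : ℕ}
    (h : ∀ c ∈ C, c < 81 ∧ rep [2, 3, 5, 7] c ≤ y) {l : ℕ} (hl : l < 3) :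
    (layer 3 C l).card ≤ stepCount capSteps₃ (y / 7 ^ l) := by
  refine card_le_stepCount₃ (hC.layer (s := 1) hl) fun a ha => ?_
  obtain ⟨ha, hac⟩ := mem_layer.1 ha
  refine ⟨ha, ?_⟩
  have hr := rep_append (ps := [2, 3, 5]) (qs := [7]) (q := l) (a := a) ha
  have hr' : rep [2, 3, 5, 7] (3 ^ 3 * l + a) = rep [2, 3, 5] a * 7 ^ l := by
    refine hr.trans ?_
    simp [rep, Nat.mod_eq_of_lt hl]
  rw [Nat.le_div_iff_mul_le (by positivity), ← hr']
  exact (h _ hac).2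

theorem card_le_capBound_stepCount {C : Finset ℕ} (hC : IsCap 4 C) {y : ℕ}
    (h : ∀ c ∈ C, c < 81 ∧ rep [2, 3, 5, 7] c ≤ y) {U : ℕ} (hU : ∀ c ∈ C, U.testBit c = true) :
    C.card ≤ capBound (stepCount capSteps₃ y) (stepCount capSteps₃ (y / 7))
      (stepCount capSteps₃ (y / 49)) U := by
  refine card_le_capBound hC (fun c hc => (h c hc).1) hU ?_ ?_ ?_
  · simpa using card_layer_le_stepCount hC h (l := 0) (by norm_num)
  · simpa using card_layer_le_stepCount hC h (l := 1) (by norm_num)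
  · simpa using card_layer_le_stepCount hC h (l := 2) (by norm_num)

theorem testJumps_capSteps₄ : (withRows decreasingOrder fun L =>
    testJumps (testCap₄ L) capSteps₄ 1) = true := by decide +kernel

theorem card_le_stepCount₄ {C : Finset ℕ} (hC : IsCap 4 C) {y : ℕ}
    (h : ∀ c ∈ C, c < 81 ∧ rep [2, 3, 5, 7] c ≤ y) : C.card ≤ stepCount capSteps₄ y := by
  refine le_stepCount (card_le_of_isCap_four hC fun c hc => (h c hc).1) fun i hi hy => ?_
  have htest := testJumps_capSteps₄
  rw [withRows_eq] at htest
  have htest := of_testJumps htest hi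
  rw [testCap₄, withLayerBounds_eq] at htest
  set z := capSteps₄[i] - 1
  have hz : ∀ c ∈ C, c < 81 ∧ rep [2, 3, 5, 7] c ≤ z := fun c hc => ⟨(h c hc).1, by
    have := (h c hc).2
    omega⟩
  have hU : ∀ c ∈ C, (smoothMask z 81).testBit c = true := fun c hc =>
    testBit_smoothMask.2 (hz c hc)
  exact prune_sound htest (card_le_capBound_stepCount hC hz hU) fun hs =>
    search_sound (Q := fun C => IsCap 4 C ∧ ∀ c ∈ C, c < 81 ∧ rep [2, 3, 5, 7] c ≤ z)
      (fun C h => ⟨h.1, fun c hc => (h.2 c hc).1⟩)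
      (fun C U hC hU => card_le_capBound_stepCount hC.1 hC.2 hU)
      nodup_decreasingOrder hs ⟨hC, hz⟩ hU (by simp)

theorem testJumps_weightSteps : (withRows increasingOrder fun L =>
    testJumps (testWeight L) weightSteps 1) = true := by decide +kernel

theorem capWeight_filter (ps : List ℕ) (C : Finset ℕ) (y : ℕ) :
    capWeight ps (C.filter fun c => rep ps c ≤ y) y = capWeight ps C y := by
  unfold capWeight
  rw [Finset.filter_filter, Finset.filter_filter]
  congr 2 <;> ext c <;> simp only [Finset.mem_filter] <;> constructor <;> rintro ⟨h1, h2⟩ <;>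
    refine ⟨h1, ?_⟩ <;> omega

theorem capWeight_mono (ps : List ℕ) (C : Finset ℕ) : Monotone (capWeight ps C) := by
  intro y z hyz
  unfold capWeight
  gcongr

theorem capWeight_le_weightBound {C : Finset ℕ} (hC : IsCap 4 C) {y : ℕ}
    (h : ∀ c ∈ C, c < 81 ∧ rep [2, 3, 5, 7] c ≤ y) {U : ℕ} (hU : ∀ c ∈ C, U.testBit c = true) :
    capWeight [2, 3, 5, 7] C y ≤ weightBound (stepCount capSteps₄ y) (stepCount capSteps₄ (y / 8))
      (stepCount capSteps₃ y) (stepCount capSteps₃ (y / 7)) (stepCount capSteps₃ (y / 49))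
      (stepCount capSteps₃ (y / 8)) (stepCount capSteps₃ (y / 8 / 7))
      (stepCount capSteps₃ (y / 8 / 49)) (smoothMask (y / 8) 81) U := by
  set D := C.filter fun c => 8 * rep [2, 3, 5, 7] c ≤ y with hD
  have hDC : D ⊆ C := Finset.filter_subset _ _
  have hDcap := hC.mono hDC
  have hDy : ∀ c ∈ D, c < 81 ∧ rep [2, 3, 5, 7] c ≤ y / 8 := fun c hc => by
    have := (Finset.mem_filter.1 hc).2
    exact ⟨(h c (hDC hc)).1, by omega⟩
  have hDU : ∀ c ∈ D, (Nat.land U (smoothMask (y / 8) 81)).testBit c = true := fun c hc => by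
    have h1 := testBit_smoothMask.2 (hDy c hc)
    have h2 : (U &&& smoothMask (y / 8) 81).testBit c = true := by
      rw [Nat.testBit_and, hU c (hDC hc), h1]; rfl
    exact h2
  have h1 : (C.filter fun c => rep [2, 3, 5, 7] c ≤ y).card ≤ C.card := Finset.card_filter_le _ _
  unfold capWeight weightBound
  rw [sub_sub_eq_min, sub_sub_eq_min]
  exact add_le_add (h1.trans (le_min (card_le_stepCount₄ hC h) (card_le_capBound_stepCount hC h hU)))
    (le_min (card_le_stepCount₄ hDcap hDy) (card_le_capBound_stepCount hDcap hDy hDU))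

theorem capWeight_le_stepCount {C : Finset ℕ} (hC : IsCap 4 C) (hlt : ∀ c ∈ C, c < 81) (y : ℕ) :
    capWeight [2, 3, 5, 7] C y ≤ stepCount weightSteps y := by
  refine le_stepCount ?_ fun i hi hy => ?_
  · have h := card_le_of_isCap_four hC hlt
    have h1 := Finset.card_filter_le C fun c => rep [2, 3, 5, 7] c ≤ y
    have h2 := Finset.card_filter_le C fun c => 8 * rep [2, 3, 5, 7] c ≤ y
    have h3 : weightSteps.length = 40 := rfl
    rw [capWeight, h3]
    omega
  · have htest := testJumps_weightSteps
    rw [withRows_eq] at htest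
    have htest := of_testJumps htest hi
    set z := weightSteps[i] - 1
    simp only [testWeight, withLayerBounds_eq, force_eq] at htest
    refine (capWeight_mono _ C (by omega : y ≤ z)).trans_lt ?_
    rw [← capWeight_filter]
    set D := C.filter fun c => rep [2, 3, 5, 7] c ≤ z
    have hD := hC.mono (Finset.filter_subset (fun c => rep [2, 3, 5, 7] c ≤ z) C)
    have hDz : ∀ c ∈ D, c < 81 ∧ rep [2, 3, 5, 7] c ≤ z := fun c hc =>
      ⟨hlt c (Finset.mem_filter.1 hc).1, (Finset.mem_filter.1 hc).2⟩
    have hU : ∀ c ∈ D, (smoothMask z 81).testBit c = true := fun c hc =>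
      testBit_smoothMask.2 (hDz c hc)
    exact prune_sound htest (capWeight_le_weightBound hD hDz hU) fun hs =>
      search_sound (Q := fun C => IsCap 4 C ∧ ∀ c ∈ C, c < 81 ∧ rep [2, 3, 5, 7] c ≤ z)
        (w := fun C => capWeight [2, 3, 5, 7] C z)
        (fun C h => ⟨h.1, fun c hc => (h.2 c hc).1⟩)
        (fun C U hC hU => capWeight_le_weightBound hC.1 hC.2 hU)
        nodup_increasingOrder hs ⟨hD, hDz⟩ hU (by simp)

theorem smoothMax_le_stepCount (k : ℕ) :
    smoothMax [2, 3, 5, 7] k ≤ stepCount weightSteps k := by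
  obtain ⟨A, hA, hs, hk, hcard⟩ := exists_card_eq_smoothMax [2, 3, 5, 7] k
  rw [← hcard]
  refine (card_le_capWeight (by decide) (by decide) hA hs hk).trans
    (capWeight_le_stepCount (isCap_image_code hA hs) ?_ k)
  intro c hc
  obtain ⟨a, -, rfl⟩ := Finset.mem_image.1 hc
  exact code_lt [2, 3, 5, 7] a

/-! ### Large sets of 11-smooth numbers -/

/-- Caps of `(ℤ/3)^5`, in the coordinates given by the primes `2, 3, 5, 7, 11`. -/
def lowerCaps : List (List ℕ) :=
  [[0, 1, 3, 4, 9, 10, 12, 13, 27, 28, 30, 31, 36, 81, 82, 84, 90],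
    [0, 1, 3, 4, 9, 13, 14, 15, 19, 27, 28, 30, 31, 36, 37, 81, 82, 84, 85, 90],
    [1, 3, 4, 6, 9, 10, 13, 14, 18, 27, 29, 30, 31, 36, 37, 39, 55, 81, 83, 84, 85, 90, 91, 108],
    [0, 4, 5, 6, 9, 10, 12, 13, 19, 27, 28, 30, 31, 36, 38, 39, 55, 81, 82, 84, 85, 90, 91, 108],
    [1, 3, 5, 7, 9, 11, 12, 14, 19, 27, 28, 33, 34, 36, 37, 39, 57, 81, 82, 84, 85, 90, 91, 93,
     108, 109, 162],
    [1, 3, 5, 7, 9, 10, 12, 13, 18, 27, 28, 30, 31, 37, 38, 39, 40, 54, 81, 82, 84, 86, 90, 91,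
     93, 108, 109],
    [1, 3, 5, 7, 9, 10, 12, 13, 18, 27, 29, 30, 32, 36, 37, 39, 40, 55, 81, 82, 84, 85, 91, 92,
     93, 94, 108, 109, 111, 117, 162],
    [0, 3, 4, 7, 10, 11, 12, 13, 18, 28, 29, 30, 31, 37, 38, 39, 42, 54, 81, 82, 84, 86, 90, 91,
     93, 94, 108, 109, 111, 117, 163],
    [0, 3, 4, 7, 9, 10, 12, 14, 19, 28, 29, 30, 31, 36, 37, 40, 42, 48, 54, 82, 83, 84, 85, 90,
     91, 93, 94, 109, 110, 111, 112, 117, 162],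
    [0, 3, 4, 7, 9, 10, 12, 14, 19, 28, 29, 30, 31, 36, 37, 40, 42, 48, 54, 81, 82, 84, 85, 90,
     94, 95, 96, 100, 108, 109, 111, 112, 117],
    [0, 1, 3, 4, 9, 11, 13, 16, 21, 27, 31, 32, 33, 36, 37, 39, 40, 46, 55, 66, 81, 82, 84, 85,
     90, 94, 95, 96, 100, 108, 109, 112, 114, 117, 118],
    [0, 1, 3, 4, 9, 11, 13, 16, 21, 27, 31, 32, 33, 36, 37, 39, 40, 46, 55, 66, 82, 83, 84, 85,
     90, 91, 94, 96, 102, 108, 109, 112, 114, 117, 118],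
    [0, 1, 3, 4, 9, 11, 13, 16, 21, 27, 31, 32, 33, 36, 37, 39, 40, 46, 55, 66, 81, 85, 86, 87,
     90, 91, 93, 94, 100, 108, 110, 113, 114, 117, 118, 120, 163],
    [1, 2, 4, 5, 9, 10, 14, 17, 22, 29, 30, 31, 35, 36, 38, 39, 41, 45, 55, 66, 81, 85, 86, 87,
     90, 91, 93, 94, 100, 108, 109, 112, 114, 117, 118, 120, 162],
    [0, 2, 4, 5, 9, 11, 12, 17, 21, 27, 30, 31, 34, 37, 38, 39, 40, 45, 56, 67, 82, 83, 86, 88,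
     90, 91, 93, 97, 108, 109, 111, 113, 117, 118, 120, 138, 166, 190],
    [0, 1, 3, 5, 9, 10, 13, 15, 22, 27, 30, 31, 34, 37, 38, 39, 40, 45, 55, 66, 81, 84, 85, 88,
     91, 92, 93, 94, 99, 108, 111, 112, 115, 118, 119, 120, 121, 126, 163],
    [0, 1, 5, 8, 13, 14, 16, 17, 19, 30, 31, 33, 34, 37, 38, 39, 42, 46, 56, 63, 85, 86, 88, 89,
     90, 92, 93, 94, 109, 110, 111, 114, 117, 119, 120, 121, 135, 163, 190],
    [0, 1, 3, 5, 9, 12, 13, 16, 19, 27, 28, 31, 33, 37, 38, 39, 40, 48, 58, 63, 81, 84, 85, 88,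
     90, 92, 93, 94, 109, 110, 111, 112, 117, 118, 121, 123, 135, 163, 192]]

/-- The jumps of a step function bounding `smoothMax [2, 3, 5, 7, 11]` from below. -/
def lowerSteps : List ℕ :=
  [1, 2, 3, 5, 6, 7, 8, 10, 11, 14, 15, 16, 21, 22, 24, 30, 33, 35, 40, 42, 48, 55, 56, 60, 66,
   70, 77, 80, 88, 98, 105, 110, 120, 140, 154, 160, 165, 176, 200, 210, 224, 231, 240, 264,
   280, 330, 385, 392, 440, 462, 480, 525, 528, 560, 660, 770, 784, 840, 880, 1056, 1155, 1320,
   1400, 1440, 1680, 1694, 1848, 2200, 2310, 2640, 3080, 3168, 4200, 4312]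

theorem stepCount_le {t : List ℕ} {m y : ℕ} (h : ∀ i (hi : i < t.length), t[i] ≤ y → i < m) :
    stepCount t y ≤ m := by
  induction t generalizing m with
  | nil => exact Nat.zero_le _
  | cons x t ih =>
    have := ih (m := m - 1) fun i hi hy => by
      have := h (i + 1) (by simpa using hi) (by simpa using hy)
      omega
    rw [stepCount_cons]
    split_ifs with hx
    · have := h 0 (by simp) (by simpa using hx)
      omega
    · omega

theorem capWeight_le_smoothMax {ps : List ℕ} (hp : ∀ p ∈ ps, p.Prime) (hn : ps.Nodup) (h2 : 2 ∈ ps)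
    {C : Finset ℕ} (hC : IsCap ps.length C) (hlt : ∀ c ∈ C, c < 3 ^ ps.length) (y : ℕ) :
    capWeight ps C y ≤ smoothMax ps y := by
  rw [← card_capSet hp hn hlt]
  exact le_smoothMax (hasPropertyP_capSet hp hn h2 hC hlt y)
    (fun a ha => isSmooth_of_mem_capSet hp h2 ha) fun a ha => (mem_capSet.1 ha).1

/-- The set of elements of a list as a bit mask. -/
def bitMask : List ℕ → ℕ
  | [] => 0
  | c :: C => Nat.lor (bitMask C) (Nat.shiftLeft 1 c)

theorem testBit_bitMask {C : List ℕ} {c : ℕ} : (bitMask C).testBit c = true ↔ c ∈ C := by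
  induction C with
  | nil => simp [bitMask]
  | cons d C ih =>
    have h : bitMask (d :: C) = bitMask C ||| 1 <<< d := rfl
    rw [h, Nat.testBit_or, Bool.or_eq_true, ih, Nat.one_shiftLeft, Nat.testBit_two_pow,
      decide_eq_true_eq, List.mem_cons, or_comm, eq_comm]

/-- Is the set of elements of the list a cap of `(ℤ/3)^r`? -/
def testIsCap (r : ℕ) (C : List ℕ) : Bool :=
  force (fun M => C.all fun x => C.all fun y =>
    cond (Nat.beq x y) true (Nat.beq (Nat.land 1 (Nat.shiftRight M (third r x y))) 0)) (bitMask C)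

theorem isCap_of_testIsCap {r : ℕ} {C : List ℕ} (h : testIsCap r C = true) : IsCap r C.toFinset := by
  rw [testIsCap, force_eq] at h
  simp only [List.all_eq_true] at h
  intro x hx y hy hxy hz
  rw [List.mem_toFinset] at hx hy hz
  have h := h x hx y hy
  have hne : Nat.beq x y = false := by
    rw [← Bool.not_eq_true, Nat.beq_eq]
    exact hxy
  have hbit := testBit_bitMask.2 hz
  rw [hne, cond_false, Nat.beq_eq] at h
  have h : 1 &&& (bitMask C >>> third r x y) = 0 := h
  simp [Nat.testBit, h] at hbit

theorem isCap_lowerCaps : ∀ C ∈ lowerCaps, IsCap 5 C.toFinset ∧ ∀ c ∈ C.toFinset, c < 3 ^ 5 := by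
  have h : ∀ C ∈ lowerCaps, testIsCap 5 C = true ∧ ∀ c ∈ C, c < 3 ^ 5 := by decide +kernel
  exact fun C hC => ⟨isCap_of_testIsCap (h C hC).1, fun c hc =>
    (h C hC).2 c (List.mem_toFinset.1 hc)⟩

theorem exists_lowerCap : ∀ i (hi : i < lowerSteps.length), ∃ C ∈ lowerCaps,
    i < capWeight [2, 3, 5, 7, 11] C.toFinset lowerSteps[i] := by
  decide +kernel

theorem stepCount_le_smoothMax (k : ℕ) :
    stepCount lowerSteps k ≤ smoothMax [2, 3, 5, 7, 11] k := by
  refine stepCount_le fun i hi hik => ?_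
  obtain ⟨C, hC, hw⟩ := exists_lowerCap i hi
  obtain ⟨h1, h2⟩ := isCap_lowerCaps C hC
  exact (hw.trans_le (capWeight_le_smoothMax (ps := [2, 3, 5, 7, 11])
    (by simp; norm_num) (by decide) (by decide) h1 h2 _)).trans_le
    (smoothMax_mono _ hik)

/-! ### Inverse squares of integers coprime to 2310, and the constants -/

/-- The sum of the inverse squares of the integers coprime to `N`; the term at `0` is `0`. -/
noncomputable def coprimeInvSq (N : ℕ) : ℝ := ∑' d : ℕ, if N.Coprime d then 1 / (d : ℝ) ^ 2 else 0

theorem coprimeInvSq_one : coprimeInvSq 1 = Real.pi ^ 2 / 6 := by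
  simp only [coprimeInvSq, Nat.coprime_one_left_iff, if_true]
  exact hasSum_zeta_two.tsum_eq

/-- An Euler factor: the terms divisible by `p` are `1 / p ^ 2` times all terms. -/
theorem coprimeInvSq_mul {N p : ℕ} (hp : p.Prime) (hpN : N.Coprime p) :
    coprimeInvSq (p * N) = (1 - 1 / (p : ℝ) ^ 2) * coprimeInvSq N := by
  have h1 : coprimeInvSq N = coprimeInvSq (p * N) +
      ∑' d : ℕ, if N.Coprime d ∧ p ∣ d then 1 / (d : ℝ) ^ 2 else 0 := by
    unfold coprimeInvSq
    rw [← (summable_ite_one_div_sq fun d => (p * N).Coprime d).tsum_add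
      (summable_ite_one_div_sq fun d => N.Coprime d ∧ p ∣ d)]
    refine tsum_congr fun d => ?_
    have : (p * N).Coprime d ↔ N.Coprime d ∧ ¬ p ∣ d := by
      rw [Nat.coprime_mul_iff_left, hp.coprime_iff_not_dvd, and_comm]
    simp only [this]
    by_cases ha : N.Coprime d <;> by_cases hb : p ∣ d <;> simp [ha, hb]
  have h2 : (∑' d : ℕ, if N.Coprime d ∧ p ∣ d then 1 / (d : ℝ) ^ 2 else 0) =
      1 / (p : ℝ) ^ 2 * coprimeInvSq N := by
    rw [coprimeInvSq, ← tsum_mul_left,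
      ← (mul_right_injective₀ hp.ne_zero).tsum_eq (f := fun d : ℕ =>
        if N.Coprime d ∧ p ∣ d then 1 / (d : ℝ) ^ 2 else 0)]
    · refine tsum_congr fun d => ?_
      have : N.Coprime (p * d) ∧ p ∣ p * d ↔ N.Coprime d := by
        rw [Nat.coprime_mul_iff_right]
        exact ⟨fun h => h.1.2, fun h => ⟨⟨hpN, h⟩, Nat.dvd_mul_right p d⟩⟩
      simp only [this]
      split_ifs
      · push_cast
        rw [mul_pow, one_div_mul_one_div]
      · simp
    · intro d hd
      have hd := (ite_ne_right_iff.1 (Function.mem_support.1 hd)).1.2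
      obtain ⟨e, rfl⟩ := hd
      exact ⟨e, rfl⟩
  linarith

theorem invSqTail_eq {N : ℕ} (hN : N ≠ 1) : invSqTail N = coprimeInvSq N - 1 := by
  have h : coprimeInvSq N = 1 + invSqTail N := by
    unfold coprimeInvSq invSqTail
    rw [(summable_ite_one_div_sq fun d => N.Coprime d).tsum_eq_add_tsum_ite 1]
    congr 1
    · simp
    · refine tsum_congr fun d => ?_
      by_cases h1 : d = 1
      · simp [h1]
      · rw [if_neg h1]
        rcases Nat.eq_zero_or_pos d with rfl | hd
        · simp [hN]
        · have : 2 ≤ d := by omega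
          simp [this]
  linarith

theorem invSqTail_2310_le : invSqTail 2310 ≤ 0.0228 := by
  have h : coprimeInvSq 2310 = (1 - 1 / 11 ^ 2) * ((1 - 1 / 7 ^ 2) * ((1 - 1 / 5 ^ 2) *
      ((1 - 1 / 3 ^ 2) * ((1 - 1 / 2 ^ 2) * (Real.pi ^ 2 / 6))))) := by
    have h2 := coprimeInvSq_mul (N := 1) (p := 2) (by norm_num) (by norm_num)
    have h3 := coprimeInvSq_mul (N := 2) (p := 3) (by norm_num) (by norm_num)
    have h5 := coprimeInvSq_mul (N := 6) (p := 5) (by norm_num) (by norm_num)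
    have h7 := coprimeInvSq_mul (N := 30) (p := 7) (by norm_num) (by norm_num)
    have h11 := coprimeInvSq_mul (N := 210) (p := 11) (by norm_num) (by norm_num)
    norm_num only at h2 h3 h5 h7 h11
    rw [h11, h7, h5, h3, h2, coprimeInvSq_one]
    norm_num
  have hpi : Real.pi ^ 2 ≤ 3.1416 ^ 2 := by
    have := Real.pi_lt_d4
    have := Real.pi_pos
    gcongr
  rw [invSqTail_eq (by norm_num), h]
  norm_num at hpi ⊢
  linarith

theorem mainTheorem3 :
    ∃ C : ℝ, (0.6919 : ℝ) ≤ C ∧ C ≤ (0.7136 : ℝ) ∧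
      Tendsto (fun n : ℕ => (maxSizeF 3 3 n : ℝ) / (n : ℝ)) atTop (𝓝 C) := by
  obtain ⟨C, hC⟩ := exists_tendsto_maxSizeF_div
  refine ⟨C, ?_, ?_, hC⟩
  · obtain ⟨v, hv, hle⟩ := exists_tendsto_le (ps := [2, 3, 5, 7, 11]) (b := lowerSteps)
      (by simp; norm_num) (by decide) stepCount_le_smoothMax
    refine le_trans ?_ (le_of_tendsto_of_tendsto' hv hC hle)
    have hprod : [2, 3, 5, 7, 11].prod = 2310 := rfl
    have htot : Nat.totient 2310 = 480 := by decide +kernel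
    have hsum : 3.4085 ≤ (lowerSteps.map fun x : ℕ => 1 / (x : ℝ)).sum := by
      simp only [lowerSteps, List.map_cons, List.map_nil, List.sum_cons, List.sum_nil]
      norm_num
    have hs := invSqTail_2310_le
    rw [hprod, htot]
    -- `0.2078 * 3.4085 = 0.7082…`, which times `0.9772` leaves a margin of `0.0002`
    calc (0.6919 : ℝ) ≤ (1 - 0.0228) * ((480 : ℕ) / (2310 : ℕ) * 3.4085) := by norm_num
      _ ≤ _ := by gcongr; linarith
  · obtain ⟨w, hw, hle⟩ := exists_tendsto_ge (ps := [2, 3, 5, 7]) (b := weightSteps)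
      (by simp; norm_num) (by decide) smoothMax_le_stepCount
    refine (le_of_tendsto_of_tendsto' hC hw hle).trans ?_
    have hprod : [2, 3, 5, 7].prod = 210 := rfl
    have htot : Nat.totient 210 = 48 := by decide +kernel
    rw [hprod, htot]
    simp only [weightSteps, List.map_cons, List.map_nil, List.sum_cons, List.sum_nil]
    norm_num
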